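/- Let $p\ge 1$ be an integer, let $\mathcal{E}_p=\{(z_1,z_2)\in\mathbb{C}^2:|z_1|^{2p}+|z_2|^{2p}<1\}$ and $\mathcal{E}_p^*=\mathcal{E}_p\setminus\{z_2=0\}$. Let $\sigma$ be the Euclidean surface area measure on the boundary $b\mathcal{E}_p$, and let $\omega_p=j^*(d^c\varphi_p\wedge dd^c\varphi_p)$ be the Monge–Ampère boundary measure of the exhaustion function $\varphi_p(z)=\frac1{2p}\log(|z_1|^{2p}+|z_2|^{2p})$, where $j:b\mathcal{E}_p\to\mathbb{C}^2$ is the inclusion and $d^c=i(\overline\partial-\partial)$. For $\nu\in\{\sigma,\omega_p\}$ with support $T$, let $\mathcal{A}(\mathcal{E}_p,\nu)$ be the space of continuous functions on $\mathcal{E}_p\cup T$ that are holomorphic on $\mathcal{E}_p$. For an integer $k\ge 0$ let $\mathcal{A}_k(\mathcal{E}_p^*,\nu)$ be the space of functions $F=z_2^{-k}G$ on $(\mathcal{E}_p\cup T)\setminus\{z_2=0\}$ with $G\in\mathcal{A}(\mathcal{E}_p,\nu)$ whose restriction to $T\setminus\{z_2=0\}$ (extended by $0$ to the $\nu$-null set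 $T\cap\{z_2=0\}$) lies in $L^2(\nu)$, and let $\mathfrak{H}^2_k(\mathcal{E}_p^*,\nu)$ be the closure in $L^2(\nu)$ of the set of these restrictions. Then: 1. $\mathfrak{H}^2_k(\mathcal{E}_p^*,\sigma)=\mathfrak{H}^2_0(\mathcal{E}_p^*,\sigma)$ for all $k\ge 0$. 2. $\mathfrak{H}^2_0(\mathcal{E}_p^*,\omega_p)\subsetneq\mathfrak{H}^2_1(\mathcal{E}_p^*,\omega_p)\subsetneq\cdots\subsetneq\mathfrak{H}^2_{p-1}(\mathcal{E}_p^*,\omega_p)=\mathfrak{H}^2_k(\mathcal{E}_p^*,\omega_p)$ for all $k\ge p$. 3. $\mathfrak{H}^2_0(\mathcal{E}_p^*,\omega_p)\supsetneq z_2\,\mathfrak{H}^2_1(\mathcal{E}_p^*,\omega_p)\supsetneq\cdots\supsetneq z_2^k\,\mathfrak{H}^2_k(\mathcal{E}_p^*,\omega_p)\supsetneq z_2^{k+1}\,\mathfrak{H}^2_{k+1}(\mathcal{E}_p^*,\omega_p)\supsetneq\cdots$, an infinite chain, where $z_2^k S=\{z_2^k g: g\in S\}$. -/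

import Mathlib

open MeasureTheory Set
open scoped ENNReal Gradient

noncomputable section

/-- `ℂ²` with its Euclidean norm. -/
abbrev C2 : Type := EuclideanSpace ℂ (Fin 2)

/-- The egg domain `{|z₁|^{2p} + |z₂|^{2p} < 1}`. -/
def egg (p : ℕ) : Set C2 := {z | ‖z 0‖ ^ (2 * p) + ‖z 1‖ ^ (2 * p) < 1}

/-- Euclidean surface area on the boundary of `Ω ⊆ ℂ²`, as a measure on `ℂ²`: the
three-dimensional Hausdorff measure, normalized as Lebesgue measure, on `bΩ`. -/
def surfaceMeasure (Ω : Set C2) : Measure C2 := (μHE[3]).restrict (frontier Ω)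

/-- The one-form `dᶜφ = i(∂̄φ - ∂φ)` of a real function, evaluated at `z` on a real tangent
vector `v`. Since `∂φ(v) = (dφ(v) - i dφ(iv))/2` and `∂̄φ(v) = (dφ(v) + i dφ(iv))/2`, this is
`-dφ(iv)`. -/
def dc (φ : C2 → ℝ) (z v : C2) : ℝ := -(fderiv ℝ φ z (Complex.I • v))

/-- The two-form `ddᶜφ`, the exterior derivative of `dᶜφ`. -/
def ddc (φ : C2 → ℝ) (z v w : C2) : ℝ :=
  fderiv ℝ (fun x => dc φ x w) z v - fderiv ℝ (fun x => dc φ x v) z w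

/-- The three-form `dᶜφ ∧ ddᶜφ`. -/
def dcWedgeDdc (φ : C2 → ℝ) (z u v w : C2) : ℝ :=
  dc φ z u * ddc φ z v w - dc φ z v * ddc φ z u w + dc φ z w * ddc φ z u v

/-- The unit vector in the direction of the gradient of `φ`. -/
def unitNormal (φ : C2 → ℝ) (z : C2) : C2 := (‖∇ φ z‖⁻¹ : ℝ) • ∇ φ z

/-- A unit vector that is complex orthogonal to the unit vector `n`. -/
def complexTangent (n : C2) : C2 := !₂[-(starRingEnd ℂ (n 1)), starRingEnd ℂ (n 0)]

/-- The Monge–Ampère boundary measure `j^*(dᶜφ ∧ ddᶜφ)` of `Ω = {φ < 0}`, where `j` is the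
inclusion of `bΩ`. For the outer unit normal `n` and `τ = complexTangent n`, the vectors
`(i n, τ, i τ)` form a positively oriented orthonormal basis of the real tangent space
of `bΩ`, so the density of the three-form with respect to surface area is its value
on this basis. -/
def mongeAmpereBoundaryMeasure (Ω : Set C2) (φ : C2 → ℝ) : Measure C2 :=
  (surfaceMeasure Ω).withDensity fun z =>
    let n := unitNormal φ z
    let τ := complexTangent n
    ENNReal.ofReal (dcWedgeDdc φ z (Complex.I • n) τ (Complex.I • τ))

/-- The exhaustion function `(1/2p) log (|z₁|^{2p} + |z₂|^{2p})` of the egg. -/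
def eggExhaustion (p : ℕ) (z : C2) : ℝ :=
  1 / (2 * (p : ℝ)) * Real.log (‖z 0‖ ^ (2 * p) + ‖z 1‖ ^ (2 * p))

/-- Surface area `σ` on the boundary of the egg. -/
def eggSigma (p : ℕ) : Measure C2 := surfaceMeasure (egg p)

/-- The Monge–Ampère boundary measure `ω_p` of the egg. -/
def eggOmega (p : ℕ) : Measure C2 := mongeAmpereBoundaryMeasure (egg p) (eggExhaustion p)

/-- `𝒜(Ω, ν) = 𝒪(Ω) ∩ 𝒞(Ω ∪ T)` with `T = supp ν`. Functions on `Ω ∪ T` are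
represented by functions on `ℂ²`, whose values off `Ω ∪ T` play no role. -/
def holoCont (Ω : Set C2) (ν : Measure C2) : Set (C2 → ℂ) :=
  {G | DifferentiableOn ℂ G Ω ∧ ContinuousOn G (Ω ∪ ν.support)}

/-- `𝒜_k(Ω^*, ν)` for `Ω^* = Ω \ V`, `V = {ψ = 0}`: the functions that equal `ψ^{-k} G` on
`(Ω ∪ T) \ V` for some `G ∈ 𝒜(Ω, ν)`, are extended by zero to `T ∩ V`, and
have square integrable boundary values. -/
def holoContPole (Ω : Set C2) (ν : Measure C2) (ψ : C2 → ℂ) (k : ℕ) : Set (C2 → ℂ) :=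
  {F | (∃ G ∈ holoCont Ω ν, ∀ z ∈ Ω ∪ ν.support, ψ z ≠ 0 → F z = (ψ z ^ k)⁻¹ * G z) ∧
    (∀ z ∈ ν.support, ψ z = 0 → F z = 0) ∧ MemLp F 2 ν}

/-- The `k`-th Hardy space `𝔥²_k(Ω^*, ν)`: the closure of the boundary values of
`𝒜_k(Ω^*, ν)` in `L²(ν)`. -/
def hardySpace (Ω : Set C2) (ν : Measure C2) (ψ : C2 → ℂ) (k : ℕ) : Set (Lp ℂ 2 ν) :=
  closure {f : Lp ℂ 2 ν | ∃ F ∈ holoContPole Ω ν ψ k, f =ᵐ[ν] F}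

/-- The set `ψ^ℓ S = {ψ^ℓ g : g ∈ S}` for `S ⊆ L²(ν)`. -/
def mulPowSet {ν : Measure C2} (ψ : C2 → ℂ) (l : ℕ) (S : Set (Lp ℂ 2 ν)) : Set (Lp ℂ 2 ν) :=
  {f | ∃ g ∈ S, f =ᵐ[ν] fun z => ψ z ^ l * g z}

/-- The minimal defining function `z₂` of the hyperplane `{z₂ = 0}`. -/
def z2 (z : C2) : ℂ := z 1

end

/-!
Both measures are invariant under the action of the torus on `ℂ²`, so by Parseval's identity on the
orbits the Laurent monomials `z ^ n` are orthogonal, and `𝔥²_k` is the closed linear span of those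
of them that are square integrable with `0 ≤ n 0` and `-k ≤ n 1`. Items 1 and 2 thus come down to
which negative powers of `z₂` are square integrable.

* For `σ`, none are: the map `z ↦ (Im z₁, z₂)` is 1-Lipschitz and sends the boundary onto a set
  containing a box, so near `0` the distribution of `z₂` dominates a multiple of Lebesgue measure
  on `ℂ`, for which `w⁻¹` is not square integrable.
* For `ω_p`, exactly `z₂ ^ (-l)` with `l < p` are: the density of `ω_p` with respect to `σ` is
  comparable to `|z₁ z₂| ^ (2 (p - 1))`.

In item 3, equality of two consecutive terms would, by the open mapping theorem, make multiplication
by `z₂` bounded below on `𝔥²_{k + 1}`. The powers of `z₁`, which concentrate on `{z₂ = 0}`, show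
that it is not.
-/

open Filter Topology UnitAddTorus Function

theorem eLpNorm_two_sq {α ε : Type*} [MeasurableSpace α] [ENorm ε] (μ : Measure α) (f : α → ε) :
    eLpNorm f 2 μ ^ 2 = ∫⁻ x, ‖f x‖ₑ ^ 2 ∂μ := by
  simpa using eLpNorm_nnreal_pow_eq_lintegral (f := f) (μ := μ) (p := 2) (by norm_num)

theorem memLp_two_withDensity_enorm_sq_iff {α : Type*} [MeasurableSpace α] {μ : Measure α}
    {f w : α → ℂ} (hf : Measurable f) (hw : Measurable w) :
    MemLp f 2 (μ.withDensity fun x => ‖w x‖ₑ ^ 2) ↔ MemLp (fun x => w x * f x) 2 μ := by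
  have hiff {g : α → ℂ} {ν : Measure α} (hg : Measurable g) :
      MemLp g 2 ν ↔ ∫⁻ x, ‖g x‖ₑ ^ 2 ∂ν < ∞ := by
    rw [← eLpNorm_two_sq, ENNReal.pow_lt_top_iff]
    simp [MemLp, hg.aestronglyMeasurable]
  rw [hiff hf, hiff (g := fun x => w x * f x) (hw.mul hf), lintegral_withDensity_eq_lintegral_mul _
    (hw.enorm.pow_const 2) (hf.enorm.pow_const 2)]
  simp only [Pi.mul_apply, enorm_mul, mul_pow]

section HaarVolume

noncomputable local instance : MeasureSpace UnitAddCircle := ⟨AddCircle.haarAddCircle⟩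

local instance : Measure.IsAddHaarMeasure (volume : Measure UnitAddCircle) :=
  inferInstanceAs (Measure.IsAddHaarMeasure AddCircle.haarAddCircle)

local instance : IsProbabilityMeasure (volume : Measure UnitAddCircle) :=
  inferInstanceAs (IsProbabilityMeasure AddCircle.haarAddCircle)

variable {ι : Type*} [Fintype ι]

variable (ι) in
/-- The normalized Haar measure of a torus. It is the measure that underlies Mathlib's
`mFourierCoeff`; there it is `volume` for an instance that is local to Mathlib's Fourier files. -/
noncomputable def torusMeasure : Measure (UnitAddTorus ι) :=
  Measure.pi fun _ => AddCircle.haarAddCircle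

instance : IsProbabilityMeasure (torusMeasure ι) :=
  inferInstanceAs (IsProbabilityMeasure (Measure.pi _))

instance : (torusMeasure ι).IsAddHaarMeasure :=
  inferInstanceAs (Measure.IsAddHaarMeasure (Measure.pi _))

theorem mFourierCoeff_eq_integral_torusMeasure (f : UnitAddTorus ι → ℂ) (n : ι → ℤ) :
    mFourierCoeff f n = ∫ t, mFourier (-n) t * f t ∂torusMeasure ι := rfl

theorem lintegral_torusMeasure_sq_eq_tsum {f : UnitAddTorus ι → ℂ} (hf : Continuous f) :
    ∫⁻ t, ‖f t‖ₑ ^ 2 ∂torusMeasure ι = ∑' n, ‖mFourierCoeff f n‖ₑ ^ 2 := by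
  have h := hasSum_sq_mFourierCoeff
    (ContinuousMap.toLp (E := ℂ) 2 (volume : Measure (UnitAddTorus ι)) ℂ ⟨f, hf⟩)
  simp only [mFourierCoeff_toLp, ContinuousMap.coe_mk] at h
  have hae := ContinuousMap.coeFn_toLp (p := 2) (𝕜 := ℂ) (volume : Measure (UnitAddTorus ι)) ⟨f, hf⟩
  rw [integral_congr_ae (hae.mono fun t ht => by rw [ht])] at h
  have hint : Integrable (fun t => ‖f t‖ ^ 2) (torusMeasure ι) :=
    (hf.norm.pow 2).integrable_of_hasCompactSupport (.of_compactSpace _)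
  calc ∫⁻ t, ‖f t‖ₑ ^ 2 ∂torusMeasure ι = ∫⁻ t, ENNReal.ofReal (‖f t‖ ^ 2) ∂torusMeasure ι := by
        simp only [ENNReal.ofReal_pow (norm_nonneg _), ofReal_norm]
    _ = ENNReal.ofReal (∫ t, ‖f t‖ ^ 2 ∂torusMeasure ι) :=
        (ofReal_integral_eq_lintegral_ofReal hint (ae_of_all _ fun _ => by positivity)).symm
    _ = ENNReal.ofReal (∑' n, ‖mFourierCoeff f n‖ ^ 2) := by rw [h.tsum_eq]; rfl
    _ = ∑' n, ‖mFourierCoeff f n‖ₑ ^ 2 := by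
        rw [ENNReal.ofReal_tsum_of_nonneg (fun _ => by positivity) h.summable]
        simp only [ENNReal.ofReal_pow (norm_nonneg _), ofReal_norm]

theorem mFourierCoeff_mFourier (m : ι → ℤ) :
    mFourierCoeff (mFourier m) = Pi.single m 1 := by
  classical
  funext n
  rw [← mFourierCoeff_toLp, ← mFourierBasis_repr, ← mFourierLp, ← coe_mFourierBasis,
    HilbertBasis.repr_self, lp.single_apply]

end HaarVolume

section TorusFourier

variable {ι : Type*} [Fintype ι]

/-- Translating along a circle subgroup does not change the integral, so it may be averaged out. -/
theorem integral_torusMeasure_eq_integral_integral_single [DecidableEq ι] {f : UnitAddTorus ι → ℂ}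
    (hf : Continuous f) (i : ι) :
    ∫ t, f t ∂torusMeasure ι =
      ∫ t, ∫ s, f (t + Pi.single i s) ∂AddCircle.haarAddCircle ∂torusMeasure ι := by
  have hsingle : Continuous fun s : UnitAddCircle => (Pi.single i s : UnitAddTorus ι) :=
    continuous_single (A := fun _ : ι => UnitAddCircle) i
  have hint : Integrable (uncurry fun t s => f (t + Pi.single i s))
      ((torusMeasure ι).prod AddCircle.haarAddCircle) := by
    refine Continuous.integrable_of_hasCompactSupport ?_ (.of_compactSpace _)
    exact hf.comp (continuous_fst.add (hsingle.comp continuous_snd))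
  rw [integral_integral_swap hint]
  simp only [integral_add_right_eq_self f, integral_const, probReal_univ, one_smul]

theorem mFourierCoeff_sub {f g : UnitAddTorus ι → ℂ} (hf : Continuous f) (hg : Continuous g)
    (n : ι → ℤ) : mFourierCoeff (f - g) n = mFourierCoeff f n - mFourierCoeff g n := by
  have hint : ∀ {h : UnitAddTorus ι → ℂ}, Continuous h →
      Integrable (fun t => mFourier (-n) t * h t) (torusMeasure ι) := fun hh =>
    ((mFourier (-n)).continuous.mul hh).integrable_of_hasCompactSupport (.of_compactSpace _)
  simp only [mFourierCoeff_eq_integral_torusMeasure, Pi.sub_apply, mul_sub]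
  exact integral_sub (hint hf) (hint hg)

theorem mFourierCoeff_const_mul (c : ℂ) (f : UnitAddTorus ι → ℂ) (n : ι → ℤ) :
    mFourierCoeff (fun t => c * f t) n = c * mFourierCoeff f n := by
  simp only [mFourierCoeff_eq_integral_torusMeasure, mul_left_comm _ c, integral_const_mul]

theorem mFourierCoeff_mFourier_mul (m : ι → ℤ) (f : UnitAddTorus ι → ℂ) (n : ι → ℤ) :
    mFourierCoeff (fun t => mFourier m t * f t) n = mFourierCoeff f (n - m) := by
  simp only [mFourierCoeff_eq_integral_torusMeasure, ← mul_assoc, ← mFourier_add]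
  congr! 4
  abel_nf

end TorusFourier

section Circle

theorem fourier_one_zpow (n : ℤ) (t : UnitAddCircle) : (fourier 1 t : ℂ) ^ n = fourier n t := by
  rw [fourier_one, fourier_apply, AddCircle.toCircle_zsmul, Circle.coe_zpow]

theorem norm_fourier_apply (n : ℤ) (t : UnitAddCircle) : ‖(fourier n t : ℂ)‖ = 1 := by
  rw [fourier_apply]; exact Circle.norm_coe _

theorem exists_fourier_one_eq {a : ℂ} (ha : ‖a‖ = 1) : ∃ t : UnitAddCircle, fourier 1 t = a := by
  obtain ⟨t, ht⟩ := (AddCircle.homeomorphCircle (one_ne_zero (α := ℝ))).surjective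
    ⟨a, mem_sphere_zero_iff_norm.2 ha⟩
  refine ⟨t, ?_⟩
  rw [fourier_one, ← AddCircle.homeomorphCircle_apply one_ne_zero, ht]

theorem integral_haarAddCircle_eq_circleAverage (φ : ℂ → ℂ) (w : ℂ) :
    ∫ t : UnitAddCircle, φ (fourier 1 t * w) ∂AddCircle.haarAddCircle =
      Real.circleAverage φ 0 ‖w‖ := by
  have hvol : (AddCircle.haarAddCircle : Measure UnitAddCircle) = volume := by
    simp [AddCircle.volume_eq_smul_haarAddCircle]
  have hangle (x : ℝ) : fourier 1 (x : UnitAddCircle) * w =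
      circleMap 0 ‖w‖ (2 * Real.pi * x + w.arg) := by
    conv_lhs => rw [← Complex.norm_mul_exp_arg_mul_I w]
    rw [fourier_coe_apply, circleMap, mul_left_comm, ← Complex.exp_add, zero_add]
    push_cast
    ring_nf
  rw [hvol, ← UnitAddCircle.intervalIntegral_preimage 0, Real.circleAverage_eq_integral_add w.arg]
  simp_rw [hangle]
  rw [intervalIntegral.integral_comp_mul_left
    (fun θ : ℝ => φ (circleMap 0 ‖w‖ (θ + w.arg))) (by positivity)]
  simp

theorem fourierCoeff_eq_circleAverage (g : ℂ → ℂ) {w : ℂ} (hw : w ≠ 0) (n : ℤ) :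
    fourierCoeff (fun t : UnitAddCircle => g (fourier 1 t * w)) n =
      Real.circleAverage (fun z => (w / z) ^ n * g z) 0 ‖w‖ := by
  rw [← integral_haarAddCircle_eq_circleAverage, fourierCoeff]
  congr! 2 with t
  have ht : w / (fourier 1 t * w) = (fourier 1 t : ℂ)⁻¹ := by
    field_simp
  rw [ht, inv_zpow', fourier_one_zpow, smul_eq_mul]

variable {g : ℂ → ℂ} {w : ℂ}

theorem fourierCoeff_natCast_of_diffContOnCl (hw : w ≠ 0)
    (hg : DiffContOnCl ℂ g (Metric.ball 0 ‖w‖)) (n : ℕ) :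
    fourierCoeff (fun t : UnitAddCircle => g (fourier 1 t * w)) n =
      w ^ n * (iteratedDeriv n g 0 / n.factorial) := by
  have hpos : 0 < ‖w‖ := norm_pos_iff.2 hw
  have hcauchy := hg.circleIntegral_one_div_sub_center_pow_smul hpos n
  have hintegrand (z : ℂ) : (z - 0)⁻¹ • ((w / z) ^ (n : ℤ) * g z) =
      w ^ n * ((1 / (z - 0) ^ (n + 1)) • g z) := by
    simp only [sub_zero, smul_eq_mul, zpow_natCast]
    ring
  rw [fourierCoeff_eq_circleAverage g hw, Real.circleAverage_eq_circleIntegral hpos.ne']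
  simp_rw [hintegrand]
  rw [circleIntegral.integral_const_mul, hcauchy]
  simp only [smul_eq_mul]
  field_simp

theorem fourierCoeff_of_neg_of_diffContOnCl (hw : w ≠ 0)
    (hg : DiffContOnCl ℂ g (Metric.ball 0 ‖w‖)) {n : ℤ} (hn : n < 0) :
    fourierCoeff (fun t : UnitAddCircle => g (fourier 1 t * w)) n = 0 := by
  obtain ⟨m, rfl⟩ := Int.eq_negSucc_of_lt_zero hn
  have hdiff : DiffContOnCl ℂ (fun z => (z / w) ^ (m + 1) • g z) (Metric.ball 0 |‖w‖|) := by
    rw [abs_norm]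
    exact (Differentiable.diffContOnCl (by fun_prop)).smul hg
  rw [fourierCoeff_eq_circleAverage g hw]
  simpa only [zpow_negSucc, ← inv_pow, inv_div, smul_eq_mul, zero_div, ne_eq, Nat.succ_ne_zero,
    not_false_eq_true, zero_pow, zero_mul] using hdiff.circleAverage

theorem fourierCoeff_comp_mul_of_diffContOnCl (hg : DiffContOnCl ℂ g (Metric.ball 0 1)) {a : ℂ}
    (ha0 : a ≠ 0) (ha : ‖a‖ ≤ 1) (n : ℤ) :
    fourierCoeff (fun t : UnitAddCircle => g (fourier 1 t * a)) n =
      a ^ n * fourierCoeff (fun t : UnitAddCircle => g (fourier 1 t)) n := by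
  have hone : DiffContOnCl ℂ g (Metric.ball 0 ‖(1 : ℂ)‖) := by rwa [norm_one]
  have ha' := hg.mono (Metric.ball_subset_ball ha)
  rcases lt_or_ge n 0 with hn | hn
  · have h1 := fourierCoeff_of_neg_of_diffContOnCl one_ne_zero hone hn
    simp only [mul_one] at h1
    rw [h1, fourierCoeff_of_neg_of_diffContOnCl ha0 ha' hn, mul_zero]
  · lift n to ℕ using hn
    have h1 := fourierCoeff_natCast_of_diffContOnCl one_ne_zero hone n
    simp only [mul_one, one_pow, one_mul] at h1
    rw [h1, fourierCoeff_natCast_of_diffContOnCl ha0 ha', zpow_natCast]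

end Circle

section Reinhardt

variable {ι : Type*}

/-- The diagonal linear map with entries `a`, applied to `z`. -/
def diagScale (a : ι → ℂ) (z : EuclideanSpace ℂ ι) : EuclideanSpace ℂ ι :=
  WithLp.toLp 2 fun i => a i * z i

@[simp]
theorem diagScale_apply (a : ι → ℂ) (z : EuclideanSpace ℂ ι) (i : ι) :
    diagScale a z i = a i * z i := rfl

theorem diagScale_diagScale (a b : ι → ℂ) (z : EuclideanSpace ℂ ι) :
    diagScale a (diagScale b z) = diagScale (a * b) z := by
  ext i
  simp only [diagScale_apply, Pi.mul_apply, mul_assoc]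

theorem diagScale_one (z : EuclideanSpace ℂ ι) : diagScale 1 z = z := by
  ext i
  simp only [diagScale_apply, Pi.one_apply, one_mul]

/-- The diagonal action of the torus on `ℂⁿ`. -/
noncomputable def torusRot (t : UnitAddTorus ι) : EuclideanSpace ℂ ι → EuclideanSpace ℂ ι :=
  diagScale fun i => fourier 1 (t i)

theorem torusRot_apply (t : UnitAddTorus ι) (z : EuclideanSpace ℂ ι) (i : ι) :
    torusRot t z i = fourier 1 (t i) * z i := rfl

theorem norm_torusRot_apply (t : UnitAddTorus ι) (z : EuclideanSpace ℂ ι) (i : ι) :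
    ‖torusRot t z i‖ = ‖z i‖ := by
  rw [torusRot_apply, norm_mul, norm_fourier_apply, one_mul]

theorem torusRot_apply_ne_zero {t : UnitAddTorus ι} {z : EuclideanSpace ℂ ι} {i : ι} :
    torusRot t z i ≠ 0 ↔ z i ≠ 0 := by
  rw [← norm_ne_zero_iff, norm_torusRot_apply, norm_ne_zero_iff]

theorem torusRot_diagScale (t : UnitAddTorus ι) (a : ι → ℂ) (z : EuclideanSpace ℂ ι) :
    torusRot t (diagScale a z) = diagScale a (torusRot t z) := by
  rw [torusRot, diagScale_diagScale, diagScale_diagScale, mul_comm]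

theorem torusRot_add (s t : UnitAddTorus ι) (z : EuclideanSpace ℂ ι) :
    torusRot (s + t) z = torusRot s (torusRot t z) := by
  ext i
  simp only [torusRot_apply, Pi.add_apply, fourier_one, AddCircle.toCircle_add, Circle.coe_mul,
    mul_assoc]

theorem torusRot_zero (z : EuclideanSpace ℂ ι) : torusRot 0 z = z := by
  ext i
  simp [torusRot_apply]

theorem exists_torusRot_eq_diagScale {a : ι → ℂ} {z : EuclideanSpace ℂ ι}
    (ha : ∀ i, z i ≠ 0 → ‖a i‖ = 1) : ∃ t, torusRot t z = diagScale a z := by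
  have hexists (i : ι) : ∃ s : UnitAddCircle, fourier 1 s * z i = a i * z i := by
    by_cases hz : z i = 0
    · exact ⟨0, by rw [hz, mul_zero, mul_zero]⟩
    · obtain ⟨s, hs⟩ := exists_fourier_one_eq (ha i hz)
      exact ⟨s, by rw [hs]⟩
  choose t ht using hexists
  exact ⟨t, PiLp.ext ht⟩

theorem torusRot_single [DecidableEq ι] (i : ι) (s : UnitAddCircle) (z : EuclideanSpace ℂ ι) :
    torusRot (Pi.single i s) z = diagScale (Pi.mulSingle i (fourier 1 s)) z := by
  ext j
  rcases eq_or_ne j i with rfl | hj <;> simp [torusRot_apply, *]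

theorem continuous_torusRot :
    Continuous fun q : UnitAddTorus ι × EuclideanSpace ℂ ι => torusRot q.1 q.2 := by
  refine (PiLp.continuous_toLp 2 _).comp (continuous_pi fun i => ?_)
  exact ((fourier 1).continuous.comp (by fun_prop)).mul (by fun_prop)

theorem differentiable_diagScale_mulSingle [Finite ι] [DecidableEq ι] (z : EuclideanSpace ℂ ι)
    (i : ι) : Differentiable ℂ fun ζ : ℂ => diagScale (Pi.mulSingle i ζ) z := by
  have := Fintype.ofFinite ι
  refine differentiable_euclidean.2 fun j => ?_
  rcases eq_or_ne j i with rfl | hj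
  · simp
  · simp [Pi.mulSingle_eq_of_ne hj]

/-- The set `K` is complete Reinhardt, and shrinking a nonzero coordinate of a point of `K` moves
the point into `Ω`, which is to be thought of as the interior of `K`. -/
structure IsStrictlyReinhardt (Ω K : Set (EuclideanSpace ℂ ι)) : Prop where
  diagScale_mem : ∀ z ∈ K, ∀ a : ι → ℂ, (∀ i, ‖a i‖ ≤ 1) → diagScale a z ∈ K
  diagScale_mem_of_lt : ∀ z ∈ K, ∀ a : ι → ℂ, (∀ i, ‖a i‖ ≤ 1) →
    (∃ i, z i ≠ 0 ∧ ‖a i‖ < 1) → diagScale a z ∈ Ω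

theorem IsStrictlyReinhardt.torusRot_mem {Ω K : Set (EuclideanSpace ℂ ι)}
    (h : IsStrictlyReinhardt Ω K) {z : EuclideanSpace ℂ ι} (hz : z ∈ K) (t : UnitAddTorus ι) :
    torusRot t z ∈ K :=
  h.diagScale_mem z hz _ fun i => (norm_fourier_apply 1 (t i)).le

theorem IsStrictlyReinhardt.continuous_comp_torusRot {Ω K : Set (EuclideanSpace ℂ ι)}
    (h : IsStrictlyReinhardt Ω K) {G : EuclideanSpace ℂ ι → ℂ} (hG : ContinuousOn G K)
    {z : EuclideanSpace ℂ ι} (hz : z ∈ K) : Continuous fun t => G (torusRot t z) :=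
  hG.comp_continuous (continuous_torusRot.comp (.prodMk_left z)) (h.torusRot_mem hz)

theorem IsStrictlyReinhardt.diffContOnCl_comp_diagScale_mulSingle [Finite ι] [DecidableEq ι]
    {Ω K : Set (EuclideanSpace ℂ ι)} (h : IsStrictlyReinhardt Ω K) {G : EuclideanSpace ℂ ι → ℂ}
    (hd : DifferentiableOn ℂ G Ω) (hG : ContinuousOn G K) {z : EuclideanSpace ℂ ι} (hz : z ∈ K)
    {i : ι} (hi : z i ≠ 0) :
    DiffContOnCl ℂ (fun ζ => G (diagScale (Pi.mulSingle i ζ) z)) (Metric.ball 0 1) := by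
  have := Fintype.ofFinite ι
  have hle {ζ : ℂ} (hζ : ‖ζ‖ ≤ 1) (j : ι) : ‖(Pi.mulSingle i ζ : ι → ℂ) j‖ ≤ 1 := by
    rcases eq_or_ne j i with rfl | hj <;> simp [*]
  have hdiff := differentiable_diagScale_mulSingle z i
  refine ⟨hd.comp hdiff.differentiableOn fun ζ hζ => ?_, ?_⟩
  · rw [mem_ball_zero_iff] at hζ
    exact h.diagScale_mem_of_lt z hz _ (hle hζ.le) ⟨i, hi, by simpa using hζ⟩
  · rw [closure_ball _ one_ne_zero]
    exact hG.comp hdiff.continuous.continuousOn fun ζ hζ =>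
      h.diagScale_mem z hz _ (hle (mem_closedBall_zero_iff.1 hζ))

variable [Fintype ι]

theorem mFourier_apply_add (n : ι → ℤ) (s t : UnitAddTorus ι) :
    mFourier n (s + t) = mFourier n s * mFourier n t := by
  simp only [mFourier, ContinuousMap.coe_mk, Pi.add_apply, fourier_apply, smul_add,
    AddCircle.toCircle_add, Circle.coe_mul, Finset.prod_mul_distrib]

theorem mFourier_apply_single [DecidableEq ι] (n : ι → ℤ) (i : ι) (s : UnitAddCircle) :
    mFourier n (Pi.single i s) = fourier (n i) s := by
  rw [mFourier, ContinuousMap.coe_mk, Finset.prod_eq_single i] <;> simp +contextual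

/-- The Laurent monomial with exponents `n`. Negative powers of a coordinate are `0` where the
coordinate vanishes. -/
noncomputable def laurentMonomial (n : ι → ℤ) (z : EuclideanSpace ℂ ι) : ℂ := ∏ i, z i ^ n i

theorem laurentMonomial_diagScale (n : ι → ℤ) (a : ι → ℂ) (z : EuclideanSpace ℂ ι) :
    laurentMonomial n (diagScale a z) = (∏ i, a i ^ n i) * laurentMonomial n z := by
  simp only [laurentMonomial, diagScale_apply, mul_zpow, Finset.prod_mul_distrib]

theorem laurentMonomial_torusRot (n : ι → ℤ) (t : UnitAddTorus ι) (z : EuclideanSpace ℂ ι) :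
    laurentMonomial n (torusRot t z) = mFourier n t * laurentMonomial n z := by
  rw [torusRot, laurentMonomial_diagScale]
  simp only [fourier_one_zpow, mFourier, ContinuousMap.coe_mk]

theorem laurentMonomial_ne_zero (n : ι → ℤ) {z : EuclideanSpace ℂ ι} (hz : ∀ i, z i ≠ 0) :
    laurentMonomial n z ≠ 0 :=
  Finset.prod_ne_zero_iff.2 fun i _ => zpow_ne_zero _ (hz i)

theorem laurentMonomial_add (m n : ι → ℤ) {z : EuclideanSpace ℂ ι} (hz : ∀ i, z i ≠ 0) :
    laurentMonomial (m + n) z = laurentMonomial m z * laurentMonomial n z := by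
  simp only [laurentMonomial, Pi.add_apply, zpow_add₀ (hz _), Finset.prod_mul_distrib]

@[fun_prop]
theorem measurable_laurentMonomial (n : ι → ℤ) : Measurable (laurentMonomial n) :=
  Finset.measurable_prod _ fun i _ =>
    ((by fun_prop : Measurable fun z : EuclideanSpace ℂ ι => z i).pow_const (n i))

namespace IsStrictlyReinhardt

variable {Ω K : Set (EuclideanSpace ℂ ι)} (h : IsStrictlyReinhardt Ω K)
  {G : EuclideanSpace ℂ ι → ℂ} {z : EuclideanSpace ℂ ι}
include h

/-- Averaging over the `i`-th circle first turns a torus coefficient into an average of Fourier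
coefficients of functions that are holomorphic in a disc. -/
theorem mFourierCoeff_comp_torusRot_diagScale_mulSingle [DecidableEq ι] (hG : ContinuousOn G K)
    (hz : z ∈ K) (n : ι → ℤ) (i : ι) {a : ℂ} (ha : ‖a‖ ≤ 1) :
    mFourierCoeff (fun t => G (torusRot t (diagScale (Pi.mulSingle i a) z))) n =
      ∫ t, mFourier (-n) t * fourierCoeff (fun s : UnitAddCircle =>
        G (diagScale (Pi.mulSingle i (fourier 1 s * a)) (torusRot t z))) (n i)
        ∂torusMeasure ι := by
  have haz : diagScale (Pi.mulSingle i a) z ∈ K := h.diagScale_mem z hz _ fun j => by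
    rcases eq_or_ne j i with rfl | hj <;> simp [*]
  have hcont : Continuous fun t =>
      mFourier (-n) t * G (torusRot t (diagScale (Pi.mulSingle i a) z)) :=
    (mFourier (-n)).continuous.mul (h.continuous_comp_torusRot hG haz)
  rw [mFourierCoeff_eq_integral_torusMeasure,
    integral_torusMeasure_eq_integral_integral_single hcont i]
  simp only [fourierCoeff, ← integral_const_mul]
  refine integral_congr_ae (ae_of_all _ fun t => integral_congr_ae (ae_of_all _ fun s => ?_))
  beta_reduce
  rw [mFourier_apply_add, mFourier_apply_single, mul_assoc, add_comm t, torusRot_add,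
    torusRot_single, torusRot_diagScale, diagScale_diagScale, ← Pi.mulSingle_mul, Pi.neg_apply,
    smul_eq_mul]

theorem mFourierCoeff_comp_torusRot_mulSingle [DecidableEq ι] (hd : DifferentiableOn ℂ G Ω)
    (hG : ContinuousOn G K) (hz : z ∈ K) (n : ι → ℤ) {i : ι} (hi : z i ≠ 0) {a : ℂ} (ha0 : a ≠ 0)
    (ha : ‖a‖ ≤ 1) :
    mFourierCoeff (fun t => G (torusRot t (diagScale (Pi.mulSingle i a) z))) n =
      a ^ n i * mFourierCoeff (fun t => G (torusRot t z)) n := by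
  have hslice (t : UnitAddTorus ι) := fourierCoeff_comp_mul_of_diffContOnCl
    (h.diffContOnCl_comp_diagScale_mulSingle hd hG (h.torusRot_mem hz t)
      (torusRot_apply_ne_zero.2 hi)) ha0 ha (n i)
  have hone := h.mFourierCoeff_comp_torusRot_diagScale_mulSingle hG hz n i (a := 1) (by simp)
  simp only [mul_one, Pi.mulSingle_one, diagScale_one] at hone
  rw [h.mFourierCoeff_comp_torusRot_diagScale_mulSingle hG hz n i ha, hone, ← integral_const_mul]
  simp only [hslice, mul_left_comm]

theorem mFourierCoeff_comp_torusRot_eq_zero (hd : DifferentiableOn ℂ G Ω)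
    (hG : ContinuousOn G K) (hz : z ∈ K) {n : ι → ℤ} {i : ι} (hi : z i ≠ 0) (hn : n i < 0) :
    mFourierCoeff (fun t => G (torusRot t z)) n = 0 := by
  classical
  have hslice (t : UnitAddTorus ι) : fourierCoeff (fun s : UnitAddCircle =>
      G (diagScale (Pi.mulSingle i (fourier 1 s * 1)) (torusRot t z))) (n i) = 0 := by
    refine fourierCoeff_of_neg_of_diffContOnCl
      (g := fun ζ => G (diagScale (Pi.mulSingle i ζ) (torusRot t z))) one_ne_zero ?_ hn
    rw [norm_one]
    exact h.diffContOnCl_comp_diagScale_mulSingle hd hG (h.torusRot_mem hz t)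
      (torusRot_apply_ne_zero.2 hi)
  have hone := h.mFourierCoeff_comp_torusRot_diagScale_mulSingle hG hz n i (a := 1) (by simp)
  simpa only [hslice, mul_zero, integral_zero, Pi.mulSingle_one, diagScale_one] using hone

theorem mFourierCoeff_comp_torusRot_diagScale (hd : DifferentiableOn ℂ G Ω)
    (hG : ContinuousOn G K) (hz : z ∈ K) (hz0 : ∀ i, z i ≠ 0) (n : ι → ℤ) {a : ι → ℂ}
    (ha0 : ∀ i, a i ≠ 0) (ha : ∀ i, ‖a i‖ ≤ 1) :
    mFourierCoeff (fun t => G (torusRot t (diagScale a z))) n =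
      (∏ i, a i ^ n i) * mFourierCoeff (fun t => G (torusRot t z)) n := by
  classical
  have hpartial (s : Finset ι) :
      mFourierCoeff (fun t => G (torusRot t (diagScale (∏ i ∈ s, Pi.mulSingle i (a i)) z))) n =
        (∏ i ∈ s, a i ^ n i) * mFourierCoeff (fun t => G (torusRot t z)) n := by
    induction s using Finset.induction_on with
    | empty => simp only [Finset.prod_empty, one_mul, diagScale_one]
    | insert i s his ih =>
      have hb (j : ι) : (∏ i ∈ s, Pi.mulSingle i (a i) : ι → ℂ) j = if j ∈ s then a j else 1 := by
        simp [Finset.prod_apply, Pi.mulSingle_apply]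
      have hmem : diagScale (∏ i ∈ s, Pi.mulSingle i (a i)) z ∈ K :=
        h.diagScale_mem z hz _ fun j => by rw [hb]; split_ifs <;> simp [ha]
      rw [Finset.prod_insert his, ← diagScale_diagScale, h.mFourierCoeff_comp_torusRot_mulSingle
        hd hG hmem n (by simp [hb, his, hz0]) (ha0 i) (ha i), ih, Finset.prod_insert his, mul_assoc]
  simpa only [Finset.univ_prod_mulSingle] using hpartial Finset.univ

theorem exists_mFourierCoeff_eq_mul_laurentMonomial (hd : DifferentiableOn ℂ G Ω)
    (hG : ContinuousOn G K) :
    ∃ C : (ι → ℤ) → ℂ, (∀ n i, n i < 0 → C n = 0) ∧ ∀ z ∈ K, (∀ i, z i ≠ 0) → ∀ n,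
      mFourierCoeff (fun t => G (torusRot t z)) n = C n * laurentMonomial n z := by
  classical
  by_cases hK : ∃ w ∈ K, ∀ i, w i ≠ 0
  swap
  · exact ⟨0, fun _ _ _ => rfl, fun z hz hz0 => absurd ⟨z, hz, hz0⟩ hK⟩
  obtain ⟨w, hw, hw0⟩ := hK
  refine ⟨fun n => mFourierCoeff (fun t => G (torusRot t w)) n / laurentMonomial n w,
    fun n i hn => ?_, fun z hz hz0 n => ?_⟩
  · simp only [h.mFourierCoeff_comp_torusRot_eq_zero hd hG hw (hw0 i) hn, zero_div]
  -- Both `z` and `w` can be scaled down to the point with coordinates `c⁻¹ * z i * w i`.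
  set c : ℂ := ((1 + ‖z‖ + ‖w‖ : ℝ) : ℂ)
  have hc : ‖c‖ = 1 + ‖z‖ + ‖w‖ := by
    rw [Complex.norm_real, Real.norm_of_nonneg (by positivity)]
  have hc0 : c ≠ 0 := norm_pos_iff.1 (by rw [hc]; positivity)
  have hscale {x : EuclideanSpace ℂ ι} (hx : ‖x‖ ≤ ‖c‖) (i : ι) : ‖c⁻¹ * x i‖ ≤ 1 := by
    rw [norm_mul, norm_inv, inv_mul_le_one₀ (norm_pos_iff.2 hc0)]
    exact (PiLp.norm_apply_le x i).trans hx
  have hz' := h.mFourierCoeff_comp_torusRot_diagScale hd hG hz hz0 n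
    (fun i => mul_ne_zero (inv_ne_zero hc0) (hw0 i))
    (hscale (by rw [hc]; linarith [norm_nonneg z]))
  have hw' := h.mFourierCoeff_comp_torusRot_diagScale hd hG hw hw0 n
    (fun i => mul_ne_zero (inv_ne_zero hc0) (hz0 i))
    (hscale (by rw [hc]; linarith [norm_nonneg w]))
  have hpoint : diagScale (fun i => c⁻¹ * w i) z = diagScale (fun i => c⁻¹ * z i) w := by
    ext i
    simp only [diagScale_apply]
    ring
  have hprod : ∏ i, (c⁻¹ : ℂ) ^ n i ≠ 0 :=
    Finset.prod_ne_zero_iff.2 fun i _ => zpow_ne_zero _ (inv_ne_zero hc0)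
  rw [hpoint, hw'] at hz'
  simp only [mul_zpow, Finset.prod_mul_distrib, mul_assoc] at hz'
  rw [div_mul_eq_mul_div, eq_div_iff (laurentMonomial_ne_zero n hw0), mul_comm,
    mul_comm _ (laurentMonomial n z)]
  exact (mul_left_cancel₀ hprod hz').symm

end IsStrictlyReinhardt

end Reinhardt

section ReinhardtMeasure

variable {ι : Type*}

/-- A finite measure on `ℂⁿ` that is invariant under the diagonal action of the torus and does not
charge the coordinate hyperplanes. -/
structure IsReinhardtMeasure (ν : Measure (EuclideanSpace ℂ ι)) : Prop where
  isFiniteMeasure : IsFiniteMeasure ν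
  measurePreserving_torusRot : ∀ t, MeasurePreserving (torusRot t) ν ν
  ae_ne_zero : ∀ᵐ z ∂ν, ∀ i, z i ≠ 0

theorem IsReinhardtMeasure.withDensity {ν : Measure (EuclideanSpace ℂ ι)}
    (hν : IsReinhardtMeasure ν) {f : EuclideanSpace ℂ ι → ℝ≥0∞} (hf : Measurable f)
    (hfin : ∫⁻ z, f z ∂ν ≠ ∞) (hinv : ∀ t z, f (torusRot t z) = f z) :
    IsReinhardtMeasure (ν.withDensity f) := by
  refine ⟨isFiniteMeasure_withDensity hfin, fun t => ?_,
    (withDensity_absolutelyContinuous ν f).ae_le hν.ae_ne_zero⟩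
  have hrot := hν.measurePreserving_torusRot t
  refine ⟨hrot.measurable, Measure.ext fun s hs => ?_⟩
  rw [Measure.map_apply hrot.measurable hs, withDensity_apply _ (hrot.measurable hs),
    withDensity_apply _ hs, ← hrot.setLIntegral_comp_preimage hs hf]
  simp only [hinv]

theorem IsReinhardtMeasure.torusRot_mem_support [Countable ι] {ν : Measure (EuclideanSpace ℂ ι)}
    (hν : IsReinhardtMeasure ν) {z : EuclideanSpace ℂ ι} (hz : z ∈ ν.support)
    (t : UnitAddTorus ι) : torusRot t z ∈ ν.support := by
  have hcont : Continuous (torusRot t) := continuous_torusRot.comp (.prodMk_right t)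
  rw [Measure.support_eq_forall_isOpen] at hz ⊢
  intro u hu huo
  rw [← (hν.measurePreserving_torusRot t).measure_preimage huo.measurableSet.nullMeasurableSet]
  exact hz _ hu (huo.preimage hcont)

variable [Fintype ι]

/-- The Fourier series of `F` on almost every torus orbit is the Laurent series with the
coefficients `C`. -/
def HasTorusExpansion (ν : Measure (EuclideanSpace ℂ ι)) (F : EuclideanSpace ℂ ι → ℂ)
    (C : (ι → ℤ) → ℂ) : Prop :=
  ∀ᵐ z ∂ν, Continuous (fun t => F (torusRot t z)) ∧
    ∀ n, mFourierCoeff (fun t => F (torusRot t z)) n = (C n • laurentMonomial n) z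

variable {ν : Measure (EuclideanSpace ℂ ι)} {F : EuclideanSpace ℂ ι → ℂ} {C : (ι → ℤ) → ℂ}

theorem mFourierCoeff_laurentMonomial_torusRot (m n : ι → ℤ) (z : EuclideanSpace ℂ ι) :
    mFourierCoeff (fun t => laurentMonomial m (torusRot t z)) n =
      (Pi.single m (laurentMonomial m z) : (ι → ℤ) → ℂ) n := by
  classical
  simp only [laurentMonomial_torusRot, mul_comm _ (laurentMonomial m z), mFourierCoeff_const_mul,
    mFourierCoeff_mFourier, Pi.single_apply, mul_ite, mul_one, mul_zero]

theorem HasTorusExpansion.sub_smul_laurentMonomial (hF : HasTorusExpansion ν F C) (c : ℂ)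
    (m : ι → ℤ) :
    HasTorusExpansion ν (F - c • laurentMonomial m) (C - Pi.single m c) := by
  classical
  filter_upwards [hF] with z ⟨hcont, hcoeff⟩
  have hmono : Continuous fun t => c * laurentMonomial m (torusRot t z) := by
    simp only [laurentMonomial_torusRot]
    fun_prop
  refine ⟨hcont.sub hmono, fun n => ?_⟩
  refine (mFourierCoeff_sub hcont hmono n).trans ?_
  rw [hcoeff, mFourierCoeff_const_mul, mFourierCoeff_laurentMonomial_torusRot]
  rcases eq_or_ne n m with rfl | h <;> simp [sub_mul, *]

theorem HasTorusExpansion.sub_sum (hF : HasTorusExpansion ν F C) (S : Finset (ι → ℤ)) :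
    HasTorusExpansion ν (F - ∑ n ∈ S, C n • laurentMonomial n)
      ((S : Set (ι → ℤ))ᶜ.indicator C) := by
  classical
  induction S using Finset.induction_on with
  | empty => simpa using hF
  | insert m S hm ih =>
    convert ih.sub_smul_laurentMonomial (C m) m using 1
    · rw [Finset.sum_insert hm, sub_sub, add_comm]
    · funext n
      rcases eq_or_ne n m with rfl | h <;> simp [indicator, *]

namespace IsReinhardtMeasure

variable (hν : IsReinhardtMeasure ν)
include hν

theorem quasiMeasurePreserving_torusRot :
    Measure.QuasiMeasurePreserving (fun q : EuclideanSpace ℂ ι × UnitAddTorus ι => torusRot q.2 q.1)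
      (ν.prod (torusMeasure ι)) ν := by
  have := hν.isFiniteMeasure
  have hmeas : Measurable fun q : EuclideanSpace ℂ ι × UnitAddTorus ι => torusRot q.2 q.1 :=
    (continuous_torusRot.comp continuous_swap).measurable
  refine ⟨hmeas, Measure.AbsolutelyContinuous.mk fun s hs hs0 => ?_⟩
  have hfibre (t : UnitAddTorus ι) : ν (torusRot t ⁻¹' s) = 0 :=
    ((hν.measurePreserving_torusRot t).measure_preimage hs.nullMeasurableSet).trans hs0
  rw [Measure.map_apply hmeas hs, Measure.prod_apply_symm (hmeas hs)]
  exact (lintegral_congr hfibre).trans lintegral_zero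

theorem lintegral_eq_lintegral_torusRot {Φ : EuclideanSpace ℂ ι → ℝ≥0∞} (hΦ : AEMeasurable Φ ν) :
    ∫⁻ z, Φ z ∂ν = ∫⁻ z, ∫⁻ t, Φ (torusRot t z) ∂torusMeasure ι ∂ν := by
  have := hν.isFiniteMeasure
  have hrot (t : UnitAddTorus ι) : ∫⁻ z, Φ (torusRot t z) ∂ν = ∫⁻ z, Φ z ∂ν := by
    have hmp := hν.measurePreserving_torusRot t
    rw [← hmp.map_eq] at hΦ
    rw [← lintegral_map' hΦ hmp.measurable.aemeasurable, hmp.map_eq]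
  rw [lintegral_lintegral_swap (f := fun z t => Φ (torusRot t z))
    (hΦ.comp_quasiMeasurePreserving hν.quasiMeasurePreserving_torusRot)]
  simp only [hrot, lintegral_const, measure_univ, mul_one]

/-- Parseval's identity on each torus orbit, integrated over the orbits. -/
theorem eLpNorm_sq_eq_tsum (hF : AEStronglyMeasurable F ν) (hC : HasTorusExpansion ν F C) :
    eLpNorm F 2 ν ^ 2 = ∑' n, eLpNorm (C n • laurentMonomial n) 2 ν ^ 2 := by
  calc eLpNorm F 2 ν ^ 2 = ∫⁻ z, ∫⁻ t, ‖F (torusRot t z)‖ₑ ^ 2 ∂torusMeasure ι ∂ν := by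
        rw [eLpNorm_two_sq, hν.lintegral_eq_lintegral_torusRot (hF.enorm.pow_const 2)]
    _ = ∫⁻ z, ∑' n, ‖(C n • laurentMonomial n) z‖ₑ ^ 2 ∂ν := by
        refine lintegral_congr_ae (hC.mono fun z hz => ?_)
        simp only [lintegral_torusMeasure_sq_eq_tsum hz.1, hz.2]
    _ = ∑' n, ∫⁻ z, ‖(C n • laurentMonomial n) z‖ₑ ^ 2 ∂ν := lintegral_tsum fun n =>
        (((measurable_laurentMonomial n).const_smul (C n)).enorm.pow_const 2).aemeasurable
    _ = ∑' n, eLpNorm (C n • laurentMonomial n) 2 ν ^ 2 := by simp only [eLpNorm_two_sq]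

theorem eLpNorm_smul_laurentMonomial_le (hF : AEStronglyMeasurable F ν)
    (hC : HasTorusExpansion ν F C) (n : ι → ℤ) :
    eLpNorm (C n • laurentMonomial n) 2 ν ≤ eLpNorm F 2 ν := by
  rw [← ENNReal.pow_le_pow_left_iff two_ne_zero, hν.eLpNorm_sq_eq_tsum hF hC]
  exact ENNReal.le_tsum n

theorem memLp_smul_laurentMonomial (hF : MemLp F 2 ν) (hC : HasTorusExpansion ν F C) (n : ι → ℤ) :
    MemLp (C n • laurentMonomial n) 2 ν :=
  ⟨((measurable_laurentMonomial n).const_smul (C n)).aestronglyMeasurable,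
    (hν.eLpNorm_smul_laurentMonomial_le hF.1 hC n).trans_lt hF.2⟩

theorem memLp_laurentMonomial (hF : MemLp F 2 ν) (hC : HasTorusExpansion ν F C) {n : ι → ℤ}
    (hn : C n ≠ 0) : MemLp (laurentMonomial n) 2 ν := by
  simpa only [smul_smul, inv_mul_cancel₀ hn, one_smul] using
    (hν.memLp_smul_laurentMonomial hF hC n).const_smul (C n)⁻¹

theorem eLpNorm_laurentMonomial_le_eLpNorm_sub (hF : AEStronglyMeasurable F ν)
    (hC : HasTorusExpansion ν F C) {n : ι → ℤ} (hn : C n = 0) :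
    eLpNorm (laurentMonomial n) 2 ν ≤ eLpNorm (F - laurentMonomial n) 2 ν := by
  classical
  have h := hC.sub_smul_laurentMonomial 1 n
  rw [one_smul] at h
  have hle := hν.eLpNorm_smul_laurentMonomial_le
    (hF.sub (measurable_laurentMonomial n).aestronglyMeasurable) h n
  rwa [Pi.sub_apply, hn, Pi.single_eq_same, zero_sub, neg_one_smul, eLpNorm_neg] at hle

theorem eLpNorm_sub_sum_sq_eq_tsum (hF : AEStronglyMeasurable F ν) (hC : HasTorusExpansion ν F C)
    (S : Finset (ι → ℤ)) :
    eLpNorm (F - ∑ n ∈ S, C n • laurentMonomial n) 2 ν ^ 2 =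
      ∑' n : {n // n ∉ S}, eLpNorm (C n • laurentMonomial n) 2 ν ^ 2 := by
  classical
  have hmeas : AEStronglyMeasurable (∑ n ∈ S, C n • laurentMonomial n) ν :=
    Finset.aestronglyMeasurable_sum S fun n _ =>
      ((measurable_laurentMonomial n).const_smul (C n)).aestronglyMeasurable
  rw [hν.eLpNorm_sq_eq_tsum (hF.sub hmeas) (hC.sub_sum S)]
  refine Eq.trans (tsum_congr fun n => ?_) (tsum_subtype (S : Set (ι → ℤ))ᶜ
    fun n => eLpNorm (C n • laurentMonomial n) 2 ν ^ 2).symm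
  by_cases hn : n ∈ S <;> simp [hn]

theorem hasSum_toLp_smul_laurentMonomial (hF : MemLp F 2 ν) (hC : HasTorusExpansion ν F C) :
    HasSum (fun n => (hν.memLp_smul_laurentMonomial hF hC n).toLp _) (hF.toLp F) := by
  have hsummable : ∑' n, eLpNorm (C n • laurentMonomial n) 2 ν ^ 2 ≠ ∞ := by
    rw [← hν.eLpNorm_sq_eq_tsum hF.1 hC]
    exact ENNReal.pow_ne_top hF.2.ne
  have hsq := ENNReal.tendsto_tsum_compl_atTop_zero hsummable
  simp only [← hν.eLpNorm_sub_sum_sq_eq_tsum hF.1 hC] at hsq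
  rw [HasSum, SummationFilter.unconditional_filter, tendsto_iff_edist_tendsto_0]
  rw [ENNReal.tendsto_nhds_zero] at hsq ⊢
  intro ε hε
  filter_upwards [hsq (ε ^ 2) (ENNReal.pow_pos hε 2)] with S hS
  have hmono := ae_all_iff.2 fun n => (hν.memLp_smul_laurentMonomial hF hC n).coeFn_toLp
  have hae : ⇑(hF.toLp F) - ⇑(∑ n ∈ S, (hν.memLp_smul_laurentMonomial hF hC n).toLp _) =ᵐ[ν]
      F - ∑ n ∈ S, C n • laurentMonomial n := by
    filter_upwards [hF.coeFn_toLp, hmono, Lp.coeFn_finsetSum S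
      fun n => (hν.memLp_smul_laurentMonomial hF hC n).toLp _] with z h1 h2 h3
    simp only [Pi.sub_apply, h1, h3, Finset.sum_apply, h2]
  rw [edist_comm, Lp.edist_def, eLpNorm_congr_ae hae]
  exact (ENNReal.pow_le_pow_left_iff two_ne_zero).1 hS

theorem hasTorusExpansion_laurentMonomial_mul (hC : HasTorusExpansion ν F C) (m : ι → ℤ) :
    HasTorusExpansion ν (laurentMonomial m * F) fun n => C (n - m) := by
  filter_upwards [hC, hν.ae_ne_zero] with z ⟨hcont, hcoeff⟩ hz
  have horbit : (fun t => (laurentMonomial m * F) (torusRot t z)) =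
      fun t => laurentMonomial m z * (mFourier m t * F (torusRot t z)) := by
    funext t
    rw [Pi.mul_apply, laurentMonomial_torusRot]
    ring
  rw [horbit]
  refine ⟨continuous_const.mul ((mFourier m).continuous.mul hcont), fun n => ?_⟩
  rw [mFourierCoeff_const_mul, mFourierCoeff_mFourier_mul, hcoeff, Pi.smul_apply, Pi.smul_apply,
    smul_eq_mul, smul_eq_mul, mul_left_comm, ← laurentMonomial_add _ _ hz, add_sub_cancel]

theorem exists_hasTorusExpansion {Ω : Set (EuclideanSpace ℂ ι)}
    (hΩ : IsStrictlyReinhardt Ω (Ω ∪ ν.support)) (hd : DifferentiableOn ℂ F Ω)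
    (hF : ContinuousOn F (Ω ∪ ν.support)) :
    ∃ C, (∀ n i, n i < 0 → C n = 0) ∧ HasTorusExpansion ν F C := by
  classical
  obtain ⟨C, hneg, hC⟩ := hΩ.exists_mFourierCoeff_eq_mul_laurentMonomial hd hF
  refine ⟨C, hneg, ?_⟩
  filter_upwards [Measure.support_mem_ae (μ := ν), hν.ae_ne_zero] with z hz hz0
  exact ⟨hΩ.continuous_comp_torusRot hF (Or.inr hz), hC z (Or.inr hz) hz0⟩

end IsReinhardtMeasure

end ReinhardtMeasure

section HardySpace

variable {Ω : Set C2} {ν : Measure C2} {k : ℕ}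

/-- The set `holoContPole Ω ν ψ k` as a complex vector space. -/
def holoContPoleSubmodule (Ω : Set C2) (ν : Measure C2) (ψ : C2 → ℂ) (k : ℕ) :
    Submodule ℂ (C2 → ℂ) where
  carrier := holoContPole Ω ν ψ k
  add_mem' := by
    rintro F F' ⟨⟨G, hG, hFG⟩, h0, hm⟩ ⟨⟨G', hG', hFG'⟩, h0', hm'⟩
    refine ⟨⟨G + G', ⟨hG.1.add hG'.1, hG.2.add hG'.2⟩, fun z hz hψ => ?_⟩,
      fun z hz hψ => ?_, hm.add hm'⟩
    · simp only [Pi.add_apply, hFG z hz hψ, hFG' z hz hψ, mul_add]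
    · simp only [Pi.add_apply, h0 z hz hψ, h0' z hz hψ, add_zero]
  zero_mem' := ⟨⟨0, ⟨differentiableOn_const 0, continuousOn_const⟩, by simp⟩, by simp, MemLp.zero⟩
  smul_mem' := by
    rintro c F ⟨⟨G, hG, hFG⟩, h0, hm⟩
    refine ⟨⟨c • G, ⟨hG.1.const_smul c, hG.2.const_smul c⟩, fun z hz hψ => ?_⟩,
      fun z hz hψ => ?_, hm.const_smul c⟩
    · simp only [Pi.smul_apply, hFG z hz hψ, smul_eq_mul, mul_left_comm]
    · simp only [Pi.smul_apply, h0 z hz hψ, smul_zero]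

/-- The boundary values of `holoContPole Ω ν ψ k`, whose closure is `hardySpace Ω ν ψ k`, as a
subspace of `L²(ν)`. -/
def boundaryValues (Ω : Set C2) (ν : Measure C2) (ψ : C2 → ℂ) (k : ℕ) :
    Submodule ℂ (Lp ℂ 2 ν) where
  carrier := {f | ∃ F ∈ holoContPole Ω ν ψ k, f =ᵐ[ν] F}
  add_mem' := by
    rintro f g ⟨F, hF, hf⟩ ⟨F', hF', hg⟩
    exact ⟨F + F', (holoContPoleSubmodule Ω ν ψ k).add_mem hF hF',
      (Lp.coeFn_add f g).trans (hf.add hg)⟩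
  zero_mem' := ⟨0, (holoContPoleSubmodule Ω ν ψ k).zero_mem, Lp.coeFn_zero ℂ 2 ν⟩
  smul_mem' := by
    rintro c f ⟨F, hF, hf⟩
    exact ⟨c • F, (holoContPoleSubmodule Ω ν ψ k).smul_mem c hF,
      (Lp.coeFn_smul c f).trans (hf.const_smul c)⟩

theorem holoContPole_subset_succ {ψ : C2 → ℂ} (hψ : Differentiable ℂ ψ) (k : ℕ) :
    holoContPole Ω ν ψ k ⊆ holoContPole Ω ν ψ (k + 1) := by
  rintro F ⟨⟨G, hG, hFG⟩, h0, hm⟩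
  refine ⟨⟨ψ * G, ⟨hψ.differentiableOn.mul hG.1, hψ.continuous.continuousOn.mul hG.2⟩,
    fun z hz hψz => ?_⟩, h0, hm⟩
  rw [hFG z hz hψz, Pi.mul_apply, pow_succ, mul_inv, mul_assoc, inv_mul_cancel_left₀ hψz]

theorem hardySpace_mono {ψ : C2 → ℂ} (hψ : Differentiable ℂ ψ) :
    Monotone (hardySpace Ω ν ψ) := fun _ _ hkl =>
  closure_mono fun _ ⟨F, hF, hf⟩ =>
    ⟨F, monotone_nat_of_le_succ (holoContPole_subset_succ hψ) hkl hF, hf⟩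

theorem differentiable_z2 : Differentiable ℂ z2 := by
  unfold z2
  fun_prop

theorem laurentMonomial_fin_two (n : Fin 2 → ℤ) (z : C2) :
    laurentMonomial n z = z 0 ^ n 0 * z 1 ^ n 1 :=
  Fin.prod_univ_two _

theorem laurentMonomial_eq_inv_z2_pow (k : ℕ) (z : C2) :
    laurentMonomial ![0, -(k : ℤ)] z = (z2 z ^ k)⁻¹ := by
  simp [laurentMonomial_fin_two, z2]

theorem indicator_laurentMonomial_mem_holoContPole {n : Fin 2 → ℤ} (h0 : 0 ≤ n 0)
    (h1 : -(k : ℤ) ≤ n 1) (hL : MemLp (laurentMonomial n) 2 ν) :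
    {z : C2 | z 1 ≠ 0}.indicator (laurentMonomial n) ∈ holoContPole Ω ν z2 k := by
  have hG : Differentiable ℂ fun z : C2 => z 0 ^ (n 0).toNat * z 1 ^ (n 1 + k).toNat := by
    fun_prop
  have hV : MeasurableSet {z : C2 | z 1 ≠ 0} :=
    (isOpen_ne_fun (by fun_prop) continuous_const).measurableSet
  refine ⟨⟨_, ⟨hG.differentiableOn, hG.continuous.continuousOn⟩, fun z _ (hz : z 1 ≠ 0) => ?_⟩,
    fun z _ hz => indicator_of_notMem (not_not.2 hz) _, hL.indicator hV⟩
  have hzk := zpow_ne_zero (k : ℤ) hz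
  rw [indicator_of_mem (s := {z : C2 | z 1 ≠ 0}) hz, laurentMonomial_fin_two, z2,
    ← zpow_natCast (z 0), ← zpow_natCast (z 1), ← zpow_natCast (z 1), Int.toNat_of_nonneg h0,
    Int.toNat_of_nonneg (by lia), zpow_add₀ hz]
  field_simp

namespace IsReinhardtMeasure

variable (hν : IsReinhardtMeasure ν)
include hν

theorem toLp_laurentMonomial_mem_boundaryValues {n : Fin 2 → ℤ} (h0 : 0 ≤ n 0)
    (h1 : -(k : ℤ) ≤ n 1) (hL : MemLp (laurentMonomial n) 2 ν) :
    hL.toLp _ ∈ boundaryValues Ω ν z2 k := by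
  refine ⟨_, indicator_laurentMonomial_mem_holoContPole h0 h1 hL, hL.coeFn_toLp.trans ?_⟩
  filter_upwards [hν.ae_ne_zero] with z hz
  exact (indicator_of_mem (s := {z : C2 | z 1 ≠ 0}) (hz 1) _).symm

variable (hΩ : IsStrictlyReinhardt Ω (Ω ∪ ν.support))
include hΩ

theorem exists_hasTorusExpansion_of_mem_holoContPole {F : C2 → ℂ}
    (hF : F ∈ holoContPole Ω ν z2 k) :
    ∃ C, (∀ n, n 0 < 0 ∨ n 1 < -(k : ℤ) → C n = 0) ∧ HasTorusExpansion ν F C := by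
  obtain ⟨⟨G, ⟨hd, hG⟩, hFG⟩, -, -⟩ := hF
  obtain ⟨C, hneg, hC⟩ := hν.exists_hasTorusExpansion hΩ hd hG
  refine ⟨fun n => C (n - ![0, -(k : ℤ)]), fun n hn => ?_, ?_⟩
  · rcases hn with hn | hn
    · exact hneg _ 0 (by simpa using hn)
    · exact hneg _ 1 (by simpa using by lia)
  filter_upwards [hν.hasTorusExpansion_laurentMonomial_mul hC ![0, -(k : ℤ)],
    Measure.support_mem_ae (μ := ν), hν.ae_ne_zero] with z hz hzν hz0
  have horbit : (fun t => F (torusRot t z)) =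
      fun t => (laurentMonomial ![0, -(k : ℤ)] * G) (torusRot t z) := by
    funext t
    rw [hFG _ (Or.inr (hν.torusRot_mem_support hzν t)) (torusRot_apply_ne_zero.2 (hz0 1)),
      Pi.mul_apply, laurentMonomial_eq_inv_z2_pow]
  rwa [horbit]

theorem hardySpace_eq_of_not_memLp {l : ℕ}
    (hl : ∀ n : Fin 2 → ℤ, 0 ≤ n 0 → n 1 < -(l : ℤ) → ¬ MemLp (laurentMonomial n) 2 ν)
    (hlk : l ≤ k) : hardySpace Ω ν z2 k = hardySpace Ω ν z2 l := by
  refine Subset.antisymm (closure_minimal ?_ isClosed_closure)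
    (hardySpace_mono differentiable_z2 hlk)
  rintro f ⟨F, hF, hf⟩
  obtain ⟨C, hC0, hC⟩ := hν.exists_hasTorusExpansion_of_mem_holoContPole hΩ hF
  have hterm (n : Fin 2 → ℤ) :
      (hν.memLp_smul_laurentMonomial hF.2.2 hC n).toLp _ ∈ boundaryValues Ω ν z2 l := by
    by_cases hn : C n = 0
    · refine ⟨0, zero_mem (holoContPoleSubmodule Ω ν z2 l), (MemLp.coeFn_toLp _).trans ?_⟩
      rw [hn, zero_smul]
    · have hL := hν.memLp_laurentMonomial hF.2.2 hC hn
      have h0 : 0 ≤ n 0 := not_lt.1 fun h => hn (hC0 n (Or.inl h))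
      have h1 : -(l : ℤ) ≤ n 1 := not_lt.1 fun h => hl n h0 h hL
      have hmem := hν.toLp_laurentMonomial_mem_boundaryValues (Ω := Ω) h0 h1 hL
      exact MemLp.toLp_const_smul (C n) hL ▸ Submodule.smul_mem _ (C n) hmem
  have hf' : f = hF.2.2.toLp F := Lp.ext (hf.trans hF.2.2.coeFn_toLp.symm)
  rw [hf']
  exact mem_closure_of_tendsto (hν.hasSum_toLp_smul_laurentMonomial hF.2.2 hC)
    (Eventually.of_forall fun S => sum_mem fun n _ => hterm n)

theorem enorm_toLp_laurentMonomial_le_of_mem_hardySpace {n : Fin 2 → ℤ} (hn : n 1 < -(k : ℤ))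
    (hL : MemLp (laurentMonomial n) 2 ν) {f : Lp ℂ 2 ν} (hf : f ∈ hardySpace Ω ν z2 k) :
    ‖hL.toLp _‖ₑ ≤ ‖f - hL.toLp _‖ₑ := by
  have hclosed : IsClosed {f : Lp ℂ 2 ν | ‖hL.toLp _‖ₑ ≤ ‖f - hL.toLp _‖ₑ} :=
    isClosed_le continuous_const (by fun_prop)
  refine closure_minimal (t := {f : Lp ℂ 2 ν | ‖hL.toLp _‖ₑ ≤ ‖f - hL.toLp _‖ₑ}) ?_ hclosed hf
  rintro f ⟨F, hF, hf⟩
  obtain ⟨C, hC0, hC⟩ := hν.exists_hasTorusExpansion_of_mem_holoContPole hΩ hF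
  have hf' : f = hF.2.2.toLp F := Lp.ext (hf.trans hF.2.2.coeFn_toLp.symm)
  rw [mem_ofPred_eq, hf', ← MemLp.toLp_sub, Lp.enorm_toLp, Lp.enorm_toLp]
  exact hν.eLpNorm_laurentMonomial_le_eLpNorm_sub hF.2.2.1 hC (hC0 n (Or.inr hn))

theorem hardySpace_ssubset_succ (hν0 : ν ≠ 0)
    (hL : MemLp (laurentMonomial ![0, -((k : ℤ) + 1)]) 2 ν) :
    hardySpace Ω ν z2 k ⊂ hardySpace Ω ν z2 (k + 1) := by
  refine ssubset_of_subset_not_subset (hardySpace_mono differentiable_z2 k.le_succ) fun hsub => ?_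
  have hmem : hL.toLp _ ∈ hardySpace Ω ν z2 (k + 1) := subset_closure <|
    hν.toLp_laurentMonomial_mem_boundaryValues (by simp) (by simp) hL
  have hle := hν.enorm_toLp_laurentMonomial_le_of_mem_hardySpace hΩ (by simp) hL (hsub hmem)
  rw [sub_self, enorm_zero, nonpos_iff_eq_zero, enorm_eq_zero] at hle
  have hfalse : ∀ᵐ _ ∂ν, False := by
    filter_upwards [hL.coeFn_toLp, hle ▸ Lp.coeFn_zero ℂ 2 ν, hν.ae_ne_zero] with z h1 h2 hz0
    exact laurentMonomial_ne_zero _ hz0 (h1.symm.trans h2)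
  exact hν0 (by simpa using hfalse)

end IsReinhardtMeasure

end HardySpace

section Multiplication

theorem eventually_mul_setLIntegral_pow_lt {α : Type*} [MeasurableSpace α] {μ : Measure α}
    [IsFiniteMeasure μ] {u : α → ℝ≥0∞} (hu : Measurable u) {s : Set α} {a b : NNReal}
    (hab : a < b) (hs : ∀ᵐ x ∂μ.restrict s, u x ≤ a) (hb : μ {x | b ≤ u x} ≠ 0) {C : ℝ≥0∞}
    (hC : C ≠ ∞) : ∀ᶠ n : ℕ in atTop, C * ∫⁻ x in s, u x ^ n ∂μ < ∫⁻ x, u x ^ n ∂μ := by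
  have hb0 : b ≠ 0 := (zero_le.trans_lt hab).ne'
  have hratio : (a / b : ℝ≥0∞) < 1 :=
    ENNReal.div_lt_of_lt_mul (by rw [one_mul]; exact_mod_cast hab)
  have hlim : Tendsto (fun n : ℕ => (a / b : ℝ≥0∞) ^ n * (C * μ s)) atTop (𝓝 0) := by
    simpa using ENNReal.Tendsto.mul_const
      (ENNReal.tendsto_pow_atTop_nhds_zero_of_lt_one hratio)
      (Or.inr (ENNReal.mul_ne_top hC (measure_ne_top μ s)))
  filter_upwards [hlim.eventually_lt_const (pos_iff_ne_zero.2 hb)] with n hn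
  have hbn0 : (b : ℝ≥0∞) ^ n ≠ 0 := pow_ne_zero n (by exact_mod_cast hb0)
  calc C * ∫⁻ x in s, u x ^ n ∂μ ≤ C * ∫⁻ _ in s, a ^ n ∂μ := by
        gcongr 1
        exact lintegral_mono_ae (hs.mono fun x hx => by gcongr)
    _ = b ^ n * ((a / b) ^ n * (C * μ s)) := by
        rw [setLIntegral_const, ← mul_assoc (_ ^ n) (_ ^ n), ← mul_pow,
          ENNReal.mul_div_cancel (by exact_mod_cast hb0) ENNReal.coe_ne_top, mul_left_comm]
    _ < b ^ n * μ {x | b ≤ u x} :=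
        (ENNReal.mul_lt_mul_iff_right hbn0 (ENNReal.pow_ne_top ENNReal.coe_ne_top)).2 hn
    _ ≤ b ^ n * μ {x | (b : ℝ≥0∞) ^ n ≤ u x ^ n} := by
        gcongr 2
        exact fun x (hx : b ≤ u x) => pow_le_pow_left' hx n
    _ ≤ ∫⁻ x, u x ^ n ∂μ := mul_meas_ge_le_lintegral (hu.pow_const n) _

theorem lintegral_le_two_mul_setLIntegral {α : Type*} [MeasurableSpace α] {μ : Measure α}
    {u w : α → ℝ≥0∞} {s : Set α} (hs : MeasurableSet s) (hu : ∫⁻ x, u x ∂μ ≠ ∞)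
    {C : ℝ≥0∞} (hC : C ≠ ∞) (hw : ∀ᵐ x ∂μ, w x ≤ C) (hws : ∀ x ∉ s, w x ≤ 2⁻¹)
    (h : ∫⁻ x, u x ∂μ ≤ ∫⁻ x, w x * u x ∂μ) :
    ∫⁻ x, u x ∂μ ≤ 2 * C * ∫⁻ x in s, u x ∂μ := by
  have hhalf : 2⁻¹ * ∫⁻ x, u x ∂μ + 2⁻¹ * ∫⁻ x, u x ∂μ ≤
      C * ∫⁻ x in s, u x ∂μ + 2⁻¹ * ∫⁻ x, u x ∂μ :=
    calc 2⁻¹ * ∫⁻ x, u x ∂μ + 2⁻¹ * ∫⁻ x, u x ∂μ = ∫⁻ x, u x ∂μ := by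
          rw [← add_mul, ENNReal.inv_two_add_inv_two, one_mul]
      _ ≤ ∫⁻ x in s, w x * u x ∂μ + ∫⁻ x in sᶜ, w x * u x ∂μ := by
          rwa [lintegral_add_compl _ hs]
      _ ≤ ∫⁻ x in s, C * u x ∂μ + ∫⁻ x in sᶜ, 2⁻¹ * u x ∂μ := by
          gcongr 1
          · exact lintegral_mono_ae ((ae_restrict_of_ae hw).mono fun x hx => by gcongr)
          · exact setLIntegral_mono' hs.compl fun x hx => by gcongr; exact hws x hx
      _ ≤ C * ∫⁻ x in s, u x ∂μ + 2⁻¹ * ∫⁻ x, u x ∂μ := by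
          rw [lintegral_const_mul' _ _ hC, lintegral_const_mul' _ _ (by simp)]
          gcongr
          exact Measure.restrict_le_self
  have hcancel := ENNReal.le_of_add_le_add_right (ENNReal.mul_ne_top (by simp) hu) hhalf
  calc ∫⁻ x, u x ∂μ = 2 * (2⁻¹ * ∫⁻ x, u x ∂μ) := by
        rw [← mul_assoc, ENNReal.mul_inv_cancel two_ne_zero ENNReal.ofNat_ne_top, one_mul]
    _ ≤ 2 * C * ∫⁻ x in s, u x ∂μ := by
        rw [mul_assoc]
        gcongr

theorem memLp_pow_of_memLp_top {α : Type*} [MeasurableSpace α] {μ : Measure α}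
    [IsFiniteMeasure μ] {f : α → ℂ} (hf : MemLp f ∞ μ) (n : ℕ) {q : ℝ≥0∞} :
    MemLp (fun x => f x ^ n) q μ := by
  suffices MemLp (fun x => f x ^ n) ∞ μ from this.mono_exponent le_top
  induction n with
  | zero => simpa using memLp_top_const (1 : ℂ)
  | succ n ih =>
    simp only [pow_succ]
    exact hf.mul ih

/-- Multiplication by the essentially bounded function `ψ` on `L²(ν)`. -/
noncomputable def mulLp {α : Type*} [MeasurableSpace α] {ν : Measure α} {ψ : α → ℂ}
    (hψ : MemLp ψ ∞ ν) : Lp ℂ 2 ν →L[ℂ] Lp ℂ 2 ν :=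
  (ContinuousLinearMap.mul ℂ ℂ).holderL ν ∞ 2 2 (hψ.toLp ψ)

section mulLp

variable {α : Type*} [MeasurableSpace α] {ν : Measure α} {ψ : α → ℂ} (hψ : MemLp ψ ∞ ν)

theorem coeFn_mulLp (f : Lp ℂ 2 ν) : mulLp hψ f =ᵐ[ν] fun x => ψ x * f x := by
  filter_upwards [(ContinuousLinearMap.mul ℂ ℂ).coeFn_holder (r := 2) (hψ.toLp ψ) f, hψ.coeFn_toLp]
    with x h1 h2
  rw [← h2]
  exact h1

theorem coeFn_mulLp_iterate (k : ℕ) (f : Lp ℂ 2 ν) :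
    (mulLp hψ)^[k] f =ᵐ[ν] fun x => ψ x ^ k * f x := by
  induction k with
  | zero => simp
  | succ k ih =>
    rw [iterate_succ_apply']
    filter_upwards [coeFn_mulLp hψ ((mulLp hψ)^[k] f), ih] with x h1 h2
    rw [h1, h2, pow_succ', mul_assoc]

theorem mulLp_injective (h0 : ∀ᵐ x ∂ν, ψ x ≠ 0) : Injective (mulLp hψ) := fun f g hfg => by
  apply Lp.ext
  filter_upwards [coeFn_mulLp hψ f, hfg ▸ coeFn_mulLp hψ g, h0] with x hf hg hx
  exact mul_left_cancel₀ hx (hf.symm.trans hg)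

end mulLp

theorem exists_enorm_le_mul_of_isClosed_image {E F : Type*} [NormedAddCommGroup E] [NormedSpace ℂ E]
    [CompleteSpace E] [NormedAddCommGroup F] [NormedSpace ℂ F] [CompleteSpace F] {M : E →L[ℂ] F}
    (hM : Injective M) {V : Submodule ℂ E} (hV : IsClosed (V : Set E))
    (hMV : IsClosed (M '' V)) : ∃ C : NNReal, ∀ f ∈ V, ‖f‖ₑ ≤ C * ‖M f‖ₑ := by
  have : CompleteSpace V := hV.completeSpace_coe
  obtain ⟨C, hC⟩ := (M.comp V.subtypeL).antilipschitz_of_injective_of_isClosed_range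
    (hM.comp Subtype.val_injective) (by
      rw [ContinuousLinearMap.coe_comp, range_comp]; simpa using hMV)
  refine ⟨C, fun f hf => ?_⟩
  simpa only [edist_eq_enorm_sub, map_zero, sub_zero] using! hC ⟨f, hf⟩ 0

variable {Ω : Set C2} {ν : Measure C2} {k : ℕ}

theorem mulPowSet_zero (ψ : C2 → ℂ) (S : Set (Lp ℂ 2 ν)) : mulPowSet ψ 0 S = S := by
  ext f
  refine ⟨fun ⟨g, hg, hfg⟩ => ?_, fun hf => ⟨f, hf, by simp⟩⟩
  rwa [Lp.ext (hfg.trans (by simp) : f =ᵐ[ν] g)]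

theorem mulLp_mem_hardySpace {ψ : C2 → ℂ} (hψ : MemLp ψ ∞ ν) {f : Lp ℂ 2 ν}
    (hf : f ∈ hardySpace Ω ν ψ (k + 1)) : mulLp hψ f ∈ hardySpace Ω ν ψ k := by
  refine map_mem_closure (mulLp hψ).continuous hf ?_
  rintro f ⟨F, ⟨⟨G, hG, hFG⟩, h0, hm⟩, hfF⟩
  refine ⟨fun z => ψ z * F z, ⟨⟨G, hG, fun z hz hψz => ?_⟩, fun z hz hψz => ?_, hm.mul hψ⟩, ?_⟩
  · simp only [hFG z hz hψz]
    rw [pow_succ', mul_inv, mul_assoc, mul_inv_cancel_left₀ hψz]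
  · simp only [h0 z hz hψz, mul_zero]
  · filter_upwards [coeFn_mulLp hψ f, hfF] with z h1 h2
    rw [h1, h2]

theorem mulPowSet_hardySpace_ssubset {ψ : C2 → ℂ} (hψ : MemLp ψ ∞ ν) (h0 : ∀ᵐ z ∂ν, ψ z ≠ 0)
    (hne : mulLp hψ '' hardySpace Ω ν ψ (k + 1) ≠ hardySpace Ω ν ψ k) :
    mulPowSet ψ (k + 1) (hardySpace Ω ν ψ (k + 1)) ⊂ mulPowSet ψ k (hardySpace Ω ν ψ k) := by
  refine ssubset_of_subset_not_subset ?_ fun hsub => hne (Subset.antisymm ?_ fun g hg => ?_)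
  · rintro f ⟨g, hg, hfg⟩
    refine ⟨mulLp hψ g, mulLp_mem_hardySpace hψ hg, ?_⟩
    filter_upwards [hfg, coeFn_mulLp hψ g] with z h1 h2
    rw [h1, h2, pow_succ, mul_assoc]
  · rintro _ ⟨f, hf, rfl⟩
    exact mulLp_mem_hardySpace hψ hf
  · obtain ⟨h, hh, he⟩ := hsub ⟨g, hg, coeFn_mulLp_iterate hψ k g⟩
    refine ⟨h, hh, Lp.ext ?_⟩
    filter_upwards [he, coeFn_mulLp_iterate hψ k g, coeFn_mulLp hψ h, h0] with z h1 h2 h3 hz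
    rw [h2, pow_succ, mul_assoc] at h1
    rw [h3, mul_left_cancel₀ (pow_ne_zero k hz) h1]

/-- The first coordinate peaks on the hyperplane `{z₂ = 0}`: away from that hyperplane, `|z₁|` is
bounded by a number below its essential supremum. -/
def PeaksOnHyperplane (ν : Measure C2) : Prop :=
  ∀ δ > (0 : ℝ), ∃ a b : NNReal, a < b ∧ (∀ᵐ z ∂ν, δ ≤ ‖z 1‖ → ‖z 0‖₊ ≤ a) ∧
    ν {z | b ≤ ‖z 0‖₊} ≠ 0

theorem PeaksOnHyperplane.exists_lintegral_lt [IsFiniteMeasure ν] (hpeak : PeaksOnHyperplane ν)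
    (h0 : MemLp (fun z : C2 => z 0) ∞ ν) (h1 : MemLp (fun z : C2 => z 1) ∞ ν) (C : NNReal) :
    ∃ n : ℕ, ∫⁻ z, (C * ‖z 1‖ₑ) ^ 2 * ‖z 0‖ₑ ^ (n * 2) ∂ν < ∫⁻ z, ‖z 0‖ₑ ^ (n * 2) ∂ν := by
  obtain ⟨δ, hδ, hCδ⟩ : ∃ δ : NNReal, 0 < δ ∧ (C * δ) ^ 2 ≤ 2⁻¹ := by
    refine ⟨(2 * (C + 1))⁻¹, by positivity, ?_⟩
    have hle : C * (2 * (C + 1))⁻¹ ≤ 2⁻¹ := by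
      rw [← div_eq_mul_inv, div_le_iff₀ (by positivity), inv_mul_cancel_left₀ two_ne_zero]
      exact le_self_add
    exact (pow_le_of_le_one zero_le (hle.trans (by norm_num)) two_ne_zero).trans hle
  obtain ⟨a, b, hab, ha, hb⟩ := hpeak δ hδ
  set s : Set C2 := {z | δ ≤ ‖z 1‖}
  have hs : MeasurableSet s := measurableSet_le (by fun_prop) (by fun_prop)
  set D : ℝ≥0∞ := (C * eLpNorm (fun z : C2 => z 1) ∞ ν) ^ 2
  have hD : D ≠ ∞ := ENNReal.pow_ne_top (ENNReal.mul_ne_top ENNReal.coe_ne_top h1.eLpNorm_ne_top)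
  obtain ⟨N, hN⟩ := eventually_atTop.1 <| eventually_mul_setLIntegral_pow_lt
    (u := fun z : C2 => ‖z 0‖ₑ) (s := s) (μ := ν) (by fun_prop) hab
    (by
      rw [ae_restrict_iff' hs]
      filter_upwards [ha] with z hz hzs
      exact_mod_cast hz hzs)
    (by simpa [enorm_eq_nnnorm] using hb) (C := 2 * D) (ENNReal.mul_ne_top (by simp) hD)
  refine ⟨N, not_le.1 fun hle => (hN (N * 2) (by lia)).not_ge ?_⟩
  refine lintegral_le_two_mul_setLIntegral hs ?_ hD ?_ ?_ hle
  · have hfin := ENNReal.pow_ne_top (n := 2) (memLp_pow_of_memLp_top (q := 2) h0 N).eLpNorm_ne_top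
    simpa only [eLpNorm_two_sq, enorm_pow, pow_mul] using hfin
  · filter_upwards [enorm_ae_le_eLpNormEssSup (fun z : C2 => z 1) ν] with z hz
    simp only [D, eLpNorm_exponent_top]
    gcongr
  · intro z hz
    have hz : ‖z 1‖₊ ≤ δ := (not_le.1 hz).le
    calc (C * ‖z 1‖ₑ) ^ 2 ≤ (C * δ) ^ 2 := by
          rw [enorm_eq_nnnorm]
          gcongr
      _ ≤ 2⁻¹ := by
          rw [← ENNReal.coe_ofNat, ← ENNReal.coe_inv two_ne_zero]
          exact_mod_cast hCδ

namespace IsReinhardtMeasure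

theorem lintegral_norm_pow_le (hν : IsReinhardtMeasure ν)
    (h0 : MemLp (fun z : C2 => z 0) ∞ ν) (hψ : MemLp z2 ∞ ν) {C : NNReal}
    (hC : ∀ f ∈ hardySpace Ω ν z2 k, ‖f‖ₑ ≤ C * ‖mulLp hψ f‖ₑ) (n : ℕ) :
    ∫⁻ z, ‖z 0‖ₑ ^ (n * 2) ∂ν ≤ ∫⁻ z, (C * ‖z 1‖ₑ) ^ 2 * ‖z 0‖ₑ ^ (n * 2) ∂ν := by
  have := hν.isFiniteMeasure
  have hmon : laurentMonomial ![(n : ℤ), 0] = fun z : C2 => z 0 ^ n := by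
    funext z
    simp [laurentMonomial_fin_two]
  have hL : MemLp (laurentMonomial ![(n : ℤ), 0]) 2 ν := by
    rw [hmon]
    exact memLp_pow_of_memLp_top h0 n
  set f := hL.toLp (laurentMonomial ![(n : ℤ), 0])
  have hf : f =ᵐ[ν] fun z => z 0 ^ n := hmon ▸ hL.coeFn_toLp
  have hψf : mulLp hψ f =ᵐ[ν] fun z => z 1 * z 0 ^ n := by
    filter_upwards [coeFn_mulLp hψ f, hf] with z hz hfz
    rw [hz, hfz, z2]
  have hle := hC f <| subset_closure <|
    hν.toLp_laurentMonomial_mem_boundaryValues (by simp) (by simp) hL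
  rw [Lp.enorm_def, Lp.enorm_def, eLpNorm_congr_ae hf, eLpNorm_congr_ae hψf] at hle
  have hsq := pow_le_pow_left' hle 2
  rw [mul_pow, eLpNorm_two_sq, eLpNorm_two_sq] at hsq
  simpa [mul_pow, enorm_mul, enorm_pow, pow_mul, mul_assoc, lintegral_const_mul'] using hsq

theorem mulLp_image_hardySpace_ne (hν : IsReinhardtMeasure ν) (hpeak : PeaksOnHyperplane ν)
    (h0 : MemLp (fun z : C2 => z 0) ∞ ν) (hψ : MemLp z2 ∞ ν) :
    mulLp hψ '' hardySpace Ω ν z2 (k + 1) ≠ hardySpace Ω ν z2 k := by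
  intro heq
  have := hν.isFiniteMeasure
  obtain ⟨C, hC⟩ := exists_enorm_le_mul_of_isClosed_image
    (mulLp_injective hψ (hν.ae_ne_zero.mono fun z hz => hz 1))
    (boundaryValues Ω ν z2 (k + 1)).isClosed_topologicalClosure
    (by
      rw [Submodule.topologicalClosure_coe]
      exact heq ▸ isClosed_closure)
  obtain ⟨n, hn⟩ := hpeak.exists_lintegral_lt h0 hψ C
  exact hn.not_ge (hν.lintegral_norm_pow_le h0 hψ hC n)

end IsReinhardtMeasure

end Multiplication

section Egg

/-- The function `|z₁|^{2p} + |z₂|^{2p}`, whose sublevel set at `1` is the egg. -/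
noncomputable def eggFun (p : ℕ) (z : C2) : ℝ := ‖z 0‖ ^ (2 * p) + ‖z 1‖ ^ (2 * p)

variable {p : ℕ}

theorem continuous_eggFun : Continuous (eggFun p) := by
  unfold eggFun
  fun_prop

theorem contDiff_eggFun {n : WithTop ℕ∞} : ContDiff ℝ n (eggFun p) := by
  have hcoord (i : Fin 2) : ContDiff ℝ n fun z : C2 => z i := by fun_prop
  unfold eggFun
  simp only [pow_mul]
  exact (((hcoord 0).norm_sq ℝ).pow p).add (((hcoord 1).norm_sq ℝ).pow p)

theorem eggFun_smul (s : ℝ) (z : C2) : eggFun p (s • z) = s ^ (2 * p) * eggFun p z := by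
  have habs : |s| ^ (2 * p) = s ^ (2 * p) := (even_two_mul p).pow_abs s
  simp only [eggFun, PiLp.smul_apply, norm_smul, Real.norm_eq_abs, mul_pow, habs, mul_add]

theorem eggFun_pos {z : C2} (hz : z ≠ 0) : 0 < eggFun p z := by
  obtain ⟨i, hi⟩ : ∃ i, z i ≠ 0 := by
    by_contra! h
    exact hz (PiLp.ext h)
  have hpos (j : Fin 2) : 0 ≤ ‖z j‖ ^ (2 * p) := by positivity
  have hi : 0 < ‖z i‖ ^ (2 * p) := by positivity
  fin_cases i
  · exact add_pos_of_pos_of_nonneg hi (hpos 1)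
  · exact add_pos_of_nonneg_of_pos (hpos 0) hi

theorem ne_zero_of_eggFun_eq_one (hp : 1 ≤ p) {z : C2} (hz : eggFun p z = 1) : z ≠ 0 := by
  rintro rfl
  have hzero : eggFun p 0 = 0 := by
    simp [eggFun, (by lia : p ≠ 0)]
  exact zero_ne_one (hzero.symm.trans hz)

theorem frontier_egg (hp : 1 ≤ p) : frontier (egg p) = {z | eggFun p z = 1} := by
  refine Subset.antisymm (frontier_lt_subset_eq continuous_eggFun continuous_const)
    fun z (hz : eggFun p z = 1) => ?_
  have hopen : IsOpen (egg p) := isOpen_lt continuous_eggFun continuous_const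
  rw [hopen.frontier_eq]
  refine ⟨?_, fun h : eggFun p z < 1 => h.ne hz⟩
  have hlim : Tendsto (fun s : ℝ => s • z) (𝓝[<] 1) (𝓝 z) := by
    have hcont : Continuous fun s : ℝ => s • z := by fun_prop
    simpa using (hcont.tendsto 1).mono_left nhdsWithin_le_nhds
  refine mem_closure_of_tendsto hlim ?_
  filter_upwards [Ioo_mem_nhdsLT (zero_lt_one' ℝ)] with s hs
  change eggFun p (s • z) < 1
  rw [eggFun_smul, hz, mul_one]
  exact pow_lt_one₀ hs.1.le hs.2 (by lia)

theorem ae_eggFun_eq_one_eggSigma (hp : 1 ≤ p) : ∀ᵐ z ∂eggSigma p, eggFun p z = 1 := by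
  filter_upwards [ae_restrict_mem (isClosed_frontier (s := egg p)).measurableSet] with z hz
  rwa [frontier_egg hp] at hz

theorem eggFun_torusRot (t : UnitAddTorus (Fin 2)) (z : C2) :
    eggFun p (torusRot t z) = eggFun p z := by
  simp only [eggFun, norm_torusRot_apply]

theorem norm_le_one_of_eggFun_le_one (hp : 1 ≤ p) {z : C2} (hz : eggFun p z ≤ 1) (i : Fin 2) :
    ‖z i‖ ≤ 1 := by
  have h0 : 0 ≤ ‖z 0‖ ^ (2 * p) := by positivity
  have h1 : 0 ≤ ‖z 1‖ ^ (2 * p) := by positivity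
  unfold eggFun at hz
  refine (pow_le_one_iff_of_nonneg (n := 2 * p) (norm_nonneg _) (by lia)).1 ?_
  fin_cases i <;> dsimp only [Fin.zero_eta, Fin.mk_one] <;> linarith

theorem eggFun_diagScale_le {a : Fin 2 → ℂ} (ha : ∀ i, ‖a i‖ ≤ 1) (z : C2) :
    eggFun p (diagScale a z) ≤ eggFun p z := by
  simp only [eggFun, diagScale_apply, norm_mul]
  gcongr <;> exact mul_le_of_le_one_left (norm_nonneg _) (ha _)

theorem eggFun_diagScale_lt (hp : 1 ≤ p) {a : Fin 2 → ℂ} (ha : ∀ i, ‖a i‖ ≤ 1) {z : C2}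
    {i : Fin 2} (hz : z i ≠ 0) (hai : ‖a i‖ < 1) : eggFun p (diagScale a z) < eggFun p z := by
  have hle (j : Fin 2) : ‖a j * z j‖ ^ (2 * p) ≤ ‖z j‖ ^ (2 * p) := by
    gcongr
    rw [norm_mul]
    exact mul_le_of_le_one_left (norm_nonneg _) (ha j)
  have hlt : ‖a i * z i‖ ^ (2 * p) < ‖z i‖ ^ (2 * p) := by
    refine pow_lt_pow_left₀ ?_ (norm_nonneg _) (by lia)
    rw [norm_mul]
    exact mul_lt_of_lt_one_left (norm_pos_iff.2 hz) hai
  fin_cases i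
  · exact add_lt_add_of_lt_of_le hlt (hle 1)
  · exact add_lt_add_of_le_of_lt (hle 0) hlt

theorem IsReinhardtMeasure.isStrictlyReinhardt_egg {ν : Measure C2} (hν : IsReinhardtMeasure ν)
    (hp : 1 ≤ p) (hae : ∀ᵐ z ∂ν, eggFun p z = 1) :
    IsStrictlyReinhardt (egg p) (egg p ∪ ν.support) := by
  have hsupport : ν.support ⊆ {z | eggFun p z = 1} :=
    Measure.support_subset_of_isClosed (isClosed_eq continuous_eggFun continuous_const) hae
  have hle : ∀ z ∈ egg p ∪ ν.support, eggFun p z ≤ 1 := by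
    rintro z (hz | hz)
    · exact le_of_lt hz
    · exact (hsupport hz).le
  have hlt : ∀ z ∈ egg p ∪ ν.support, ∀ a : Fin 2 → ℂ, (∀ i, ‖a i‖ ≤ 1) →
      (∃ i, z i ≠ 0 ∧ ‖a i‖ < 1) → diagScale a z ∈ egg p := fun z hz a ha ⟨i, hzi, hai⟩ =>
    (eggFun_diagScale_lt hp ha hzi hai).trans_le (hle z hz)
  refine ⟨fun z hz a ha => ?_, hlt⟩
  rcases hz with hz | hz
  · exact Or.inl ((eggFun_diagScale_le ha z).trans_lt hz)
  by_cases h : ∃ i, z i ≠ 0 ∧ ‖a i‖ < 1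
  · exact Or.inl (hlt z (Or.inr hz) a ha h)
  · push Not at h
    obtain ⟨t, ht⟩ := exists_torusRot_eq_diagScale fun i hi => (ha i).antisymm (h i hi)
    exact Or.inr (ht ▸ hν.torusRot_mem_support hz t)

theorem memLp_top_apply_of_ae_eggFun_eq_one {ν : Measure C2} (hp : 1 ≤ p)
    (hae : ∀ᵐ z ∂ν, eggFun p z = 1) (i : Fin 2) : MemLp (fun z : C2 => z i) ∞ ν := by
  refine memLp_top_of_bound (by fun_prop) 1 ?_
  filter_upwards [hae] with z hz
  exact norm_le_one_of_eggFun_le_one hp hz.le i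

theorem memLp_laurentMonomial_of_ae_eggFun_eq_one {ν : Measure C2} [IsFiniteMeasure ν] (hp : 1 ≤ p)
    (hae : ∀ᵐ z ∂ν, eggFun p z = 1) {n : Fin 2 → ℤ} (hn : 0 ≤ n) :
    MemLp (laurentMonomial n) 2 ν := by
  refine .of_bound (measurable_laurentMonomial n).aestronglyMeasurable 1 ?_
  filter_upwards [hae] with z hz
  rw [laurentMonomial, norm_prod]
  refine Finset.prod_le_one (fun i _ => norm_nonneg _) fun i _ => ?_
  obtain ⟨k, hk⟩ := Int.eq_ofNat_of_zero_le (hn i)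
  rw [hk, zpow_natCast, norm_pow]
  exact pow_le_one₀ (norm_nonneg _) (norm_le_one_of_eggFun_le_one hp hz.le i)

end Egg

section SurfaceMeasure

theorem euclideanHausdorffMeasure_lt_top_of_contDiff_image {n : ℕ} {E : Type*}
    [NormedAddCommGroup E] [NormedSpace ℝ E] [MeasurableSpace E] [BorelSpace E]
    {f : (Fin n → ℝ) → E} (hf : ContDiff ℝ 1 f) {Q : Set (Fin n → ℝ)} (hQ : IsCompact Q) :
    μHE[n] (f '' Q) < ∞ := by
  obtain ⟨K, hK⟩ :=
    (hf.locallyLipschitz.locallyLipschitzOn (s := Q)).exists_lipschitzOnWith_of_compact hQ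
  have hvolume : (μH[n] : Measure (Fin n → ℝ)) = volume := by
    simpa using hausdorffMeasure_pi_real (ι := Fin n)
  rw [Measure.euclideanHausdorffMeasure_def, Measure.smul_apply]
  refine ENNReal.mul_lt_top ENNReal.coe_lt_top
    ((hK.hausdorffMeasure_image_le (d := n) (by positivity)).trans_lt ?_)
  rw [hvolume]
  exact ENNReal.mul_lt_top (ENNReal.rpow_lt_top_of_nonneg (by positivity) ENNReal.coe_ne_top)
    hQ.measure_lt_top

/-- The parametrization of the unit sphere of `ℂ²` by the polar angle of `(|z₁|, |z₂|)` and the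
arguments of `z₁` and `z₂`. -/
noncomputable def sphereParam (x : Fin 3 → ℝ) : C2 :=
  !₂[Real.cos (x 0) * Complex.exp (x 1 * Complex.I), Real.sin (x 0) * Complex.exp (x 2 * Complex.I)]

theorem contDiff_sphereParam : ContDiff ℝ 1 sphereParam := by
  have hof {f : (Fin 3 → ℝ) → ℝ} (hf : ContDiff ℝ 1 f) : ContDiff ℝ 1 fun x => (f x : ℂ) :=
    Complex.ofRealCLM.contDiff.comp hf
  have hexp (i : Fin 3) : ContDiff ℝ 1 fun x : Fin 3 → ℝ => Complex.exp (x i * Complex.I) :=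
    ((hof (contDiff_apply ℝ ℝ i)).mul contDiff_const).cexp
  rw [contDiff_piLp 2]
  intro i
  fin_cases i
  · exact (hof (by fun_prop)).mul (hexp 1)
  · exact (hof (by fun_prop)).mul (hexp 2)

theorem norm_sphereParam (x : Fin 3 → ℝ) : ‖sphereParam x‖ = 1 := by
  simp [EuclideanSpace.norm_eq, sphereParam, Complex.norm_exp_ofReal_mul_I, -Complex.ofReal_cos,
    -Complex.ofReal_sin, Real.cos_sq_add_sin_sq]

theorem exists_norm_smul_sphereParam_eq (z : C2) :
    ∃ x ∈ Icc (fun _ => -Real.pi) (fun _ => Real.pi), ‖z‖ • sphereParam x = z := by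
  set c : ℂ := ⟨‖z 0‖, ‖z 1‖⟩
  have hc : ‖z‖ = ‖c‖ := by
    rw [EuclideanSpace.norm_eq, Complex.norm_eq_sqrt_sq_add_sq, Fin.sum_univ_two]
  refine ⟨![c.arg, (z 0).arg, (z 1).arg], ⟨fun i => ?_, fun i => ?_⟩, ?_⟩
  · fin_cases i <;> exact (Complex.neg_pi_lt_arg _).le
  · fin_cases i <;> exact Complex.arg_le_pi _
  have hcos : (‖c‖ : ℂ) * Real.cos c.arg = ‖z 0‖ := by
    exact_mod_cast Complex.norm_mul_cos_arg c
  have hsin : (‖c‖ : ℂ) * Real.sin c.arg = ‖z 1‖ := by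
    exact_mod_cast Complex.norm_mul_sin_arg c
  ext i
  fin_cases i
  · simp [sphereParam, hc, ← mul_assoc, -Complex.ofReal_cos, hcos]
  · simp [sphereParam, hc, ← mul_assoc, -Complex.ofReal_sin, hsin]

variable {p : ℕ}

theorem frontier_egg_subset_image (hp : 1 ≤ p) : frontier (egg p) ⊆
    (fun x => eggFun p (sphereParam x) ^ (-(2 * p : ℝ)⁻¹) • sphereParam x) ''
      Icc (fun _ => -Real.pi) (fun _ => Real.pi) := by
  rw [frontier_egg hp]
  intro z (hz : eggFun p z = 1)
  obtain ⟨x, hx, hxz⟩ := exists_norm_smul_sphereParam_eq z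
  refine ⟨x, hx, ?_⟩
  have hpow : ‖z‖ ^ (2 * p) * eggFun p (sphereParam x) = 1 := by
    rw [← eggFun_smul, hxz, hz]
  have hnorm : eggFun p (sphereParam x) ^ (-(2 * p : ℝ)⁻¹) = ‖z‖ := by
    rw [eq_inv_of_mul_eq_one_right hpow, Real.inv_rpow (by positivity),
      Real.rpow_neg (by positivity), inv_inv]
    exact_mod_cast Real.pow_rpow_inv_natCast (norm_nonneg z) (by lia : 2 * p ≠ 0)
  simp only [hnorm, hxz]

theorem isFiniteMeasure_eggSigma (hp : 1 ≤ p) : IsFiniteMeasure (eggSigma p) := by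
  have hparam : ContDiff ℝ 1 fun x =>
      eggFun p (sphereParam x) ^ (-(2 * p : ℝ)⁻¹) • sphereParam x := by
    have hpos (x) : eggFun p (sphereParam x) ≠ 0 :=
      (eggFun_pos (norm_ne_zero_iff.1 (by simp [norm_sphereParam]))).ne'
    exact ((contDiff_eggFun.comp contDiff_sphereParam).rpow_const_of_ne hpos).smul
      contDiff_sphereParam
  refine ⟨?_⟩
  rw [eggSigma, surfaceMeasure, Measure.restrict_apply_univ]
  exact (measure_mono (frontier_egg_subset_image hp)).trans_lt
    (euclideanHausdorffMeasure_lt_top_of_contDiff_image hparam isCompact_Icc)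

theorem isometry_torusRot {ι : Type*} [Fintype ι] (t : UnitAddTorus ι) :
    Isometry (torusRot t) := by
  refine Isometry.of_dist_eq fun z w => ?_
  rw [EuclideanSpace.dist_eq, EuclideanSpace.dist_eq]
  simp only [torusRot_apply, dist_eq_norm, ← mul_sub, norm_mul,
    norm_fourier_apply, one_mul]

theorem measurePreserving_torusRot_eggSigma (hp : 1 ≤ p) (t : UnitAddTorus (Fin 2)) :
    MeasurePreserving (torusRot t) (eggSigma p) (eggSigma p) := by
  let e : C2 ≃ᵢ C2 := .mk' (torusRot t) (torusRot (-t))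
    (fun z => by rw [← torusRot_add, add_neg_cancel, torusRot_zero]) (isometry_torusRot t)
  have hpreimage : e ⁻¹' frontier (egg p) = frontier (egg p) := by
    rw [frontier_egg hp]
    exact ext fun z => by simp [e, IsometryEquiv.mk', eggFun_torusRot]
  have he := (e.measurePreserving_euclideanHausdorffMeasure 3).restrict_preimage
    (s := frontier (egg p)) isClosed_frontier.measurableSet
  rwa [hpreimage] at he

theorem euclideanHausdorffMeasure_eq_zero_of_dimH_lt {E : Type*} [MetricSpace E]
    [MeasurableSpace E] [BorelSpace E] {s : Set E} {d : ℕ} (h : dimH s < d) : μHE[d] s = 0 := by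
  have hμH : μH[d] s = 0 := by
    simpa using hausdorffMeasure_of_dimH_lt (s := s) (d := d) (by exact_mod_cast h)
  rw [Measure.euclideanHausdorffMeasure_def, Measure.smul_apply, hμH, smul_zero]

theorem dimH_coordinate_hyperplane_lt (i : Fin 2) : dimH {z : C2 | z i = 0} < 3 := by
  have hsingle : ContDiff ℝ 1 fun w : ℂ => (EuclideanSpace.single (i + 1) w : C2) := by
    refine (contDiff_piLp 2).2 fun j => ?_
    by_cases hj : j = i + 1
    · simpa [hj] using contDiff_fun_id
    · simpa [hj] using contDiff_const
  have hsubset : {z : C2 | z i = 0} ⊆ range fun w => EuclideanSpace.single (i + 1) w := by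
    refine fun z (hz : z i = 0) => ⟨z (i + 1), PiLp.ext fun j => ?_⟩
    fin_cases i <;> fin_cases j <;> simp_all
  calc dimH {z : C2 | z i = 0} ≤ Module.finrank ℝ ℂ :=
        (dimH_mono hsubset).trans hsingle.dimH_range_le
    _ < 3 := by
        rw [Complex.finrank_real_complex]
        norm_num

theorem isReinhardtMeasure_eggSigma (hp : 1 ≤ p) : IsReinhardtMeasure (eggSigma p) where
  isFiniteMeasure := isFiniteMeasure_eggSigma hp
  measurePreserving_torusRot := measurePreserving_torusRot_eggSigma hp
  ae_ne_zero := ae_all_iff.2 fun i => ae_restrict_of_ae <| measure_eq_zero_iff_ae_notMem.1 <|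
    euclideanHausdorffMeasure_eq_zero_of_dimH_lt (dimH_coordinate_hyperplane_lt i)

end SurfaceMeasure

section SurfaceIntegrability

theorem not_memLp_inv_volume_ball {r : ℝ} (hr : 0 < r) :
    ¬ MemLp (fun w : ℂ => w⁻¹) 2 (volume.restrict (Metric.ball 0 r)) := by
  intro h
  have hsq : IntegrableOn (fun w : ℂ => (‖w‖⁻¹) ^ 2) (Metric.ball 0 r) := by
    simpa only [norm_inv, IntegrableOn] using (memLp_two_iff_integrable_sq_norm h.1).1 h
  have hpolar := (integrableOn_fun_norm_addHaar volume (f := fun y : ℝ => y⁻¹ ^ 2)).1 hsq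
  have hinv : IntegrableOn (fun y : ℝ => y ^ (-1 : ℝ)) (Ioo 0 r) := by
    refine hpolar.congr_fun (fun y hy => ?_) measurableSet_Ioo
    have hy : y ≠ 0 := hy.1.ne'
    simp only [Complex.finrank_real_complex, Nat.add_one_sub_one, pow_one, smul_eq_mul,
      Real.rpow_neg_one]
    field_simp
  exact lt_irrefl _ ((intervalIntegral.integrableOn_Ioo_rpow_iff hr).1 hinv)

theorem hausdorffMeasure_restrict_image_le_map {X Y : Type*} [EMetricSpace X] [EMetricSpace Y]
    [MeasurableSpace X] [BorelSpace X] [MeasurableSpace Y] [BorelSpace Y] {f : X → Y}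
    (hf : LipschitzWith 1 f) {d : ℝ} (hd : 0 ≤ d) (S : Set X) :
    (μH[d] : Measure Y).restrict (f '' S) ≤ ((μH[d] : Measure X).restrict S).map f := by
  refine Measure.le_iff.2 fun A hA => ?_
  have hfm : Measurable f := hf.continuous.measurable
  rw [Measure.restrict_apply hA, Measure.map_apply hfm hA, Measure.restrict_apply (hfm hA),
    inter_comm A, ← image_inter_preimage, inter_comm S]
  simpa using hf.hausdorffMeasure_image_le hd (f ⁻¹' A ∩ S)

theorem exists_hausdorffMeasure_eq_smul {E : Type*} [NormedAddCommGroup E] [NormedSpace ℝ E]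
    [FiniteDimensional ℝ E] [MeasurableSpace E] [BorelSpace E] (μ : Measure E)
    [μ.IsAddHaarMeasure] :
    ∃ c : NNReal, c ≠ 0 ∧ (μH[Module.finrank ℝ E] : Measure E) = c • μ :=
  have := isAddHaarMeasure_hausdorffMeasure (E := E)
  ⟨_, (Measure.addHaarScalarFactor_pos_of_isAddHaarMeasure _ _).ne',
    Measure.isAddLeftInvariant_eq_smul _ _⟩

variable {p : ℕ}

theorem prod_ball_subset_image_frontier_egg (hp : 1 ≤ p) :
    Icc (-(1 / 2) : ℝ) (1 / 2) ×ˢ Metric.ball (0 : ℂ) (1 / 2) ⊆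
      (fun z : C2 => ((z 0).im, z 1)) '' frontier (egg p) := by
  rintro ⟨y, w⟩ ⟨hy, hw⟩
  have hw : ‖w‖ < 1 / 2 := by simpa using hw
  have hcont : Continuous fun x : ℝ => (!₂[x + y * Complex.I, w] : C2) :=
    (PiLp.continuous_toLp 2 _).comp (by fun_prop)
  have hsmall {r : ℝ} (h0 : 0 ≤ r) (h1 : r ≤ 1 / 2) : r ^ (2 * p) ≤ 1 / 2 :=
    (pow_le_of_le_one h0 (by linarith) (by lia)).trans h1
  have hlower : eggFun p !₂[((0 : ℝ) : ℂ) + y * Complex.I, w] ≤ 1 := by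
    have hnorm : ‖((0 : ℝ) : ℂ) + y * Complex.I‖ = |y| := by simp
    change ‖((0 : ℝ) : ℂ) + y * Complex.I‖ ^ (2 * p) + ‖w‖ ^ (2 * p) ≤ 1
    rw [hnorm]
    linarith [hsmall (abs_nonneg y) (abs_le.2 hy), hsmall (norm_nonneg w) hw.le]
  have hupper : 1 ≤ eggFun p !₂[((1 : ℝ) : ℂ) + y * Complex.I, w] := by
    have hnorm : 1 ≤ ‖((1 : ℝ) : ℂ) + y * Complex.I‖ := by
      simpa using Complex.re_le_norm (((1 : ℝ) : ℂ) + y * Complex.I)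
    exact le_add_of_le_of_nonneg (one_le_pow₀ hnorm) (by positivity)
  obtain ⟨x, -, hx⟩ := intermediate_value_Icc zero_le_one
    (continuous_eggFun.comp hcont).continuousOn ⟨hlower, hupper⟩
  refine ⟨_, (frontier_egg hp).ge hx, ?_⟩
  simp

theorem lipschitzWith_im_fst_prod_snd : LipschitzWith 1 fun z : C2 => ((z 0).im, z 1) := by
  have hcoord (i : Fin 2) : LipschitzWith 1 fun z : C2 => z i :=
    LipschitzWith.of_dist_le_mul fun z w => by
      simpa [dist_eq_norm] using PiLp.norm_apply_le (z - w) i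
  simpa using (((LipschitzWith.of_dist_le_mul fun z w => by
    simpa [Real.dist_eq, Complex.dist_eq] using Complex.abs_im_le_norm (z - w)).comp
      (hcoord 0)).prodMk (hcoord 1) : LipschitzWith (max (1 * 1) 1) _)

theorem exists_smul_volume_ball_le_map_eggSigma (hp : 1 ≤ p) : ∃ c : NNReal, c ≠ 0 ∧
    c • (volume : Measure ℂ).restrict (Metric.ball 0 (1 / 2)) ≤ (eggSigma p).map z2 := by
  obtain ⟨c, hc, hvolume⟩ := exists_hausdorffMeasure_eq_smul
    ((volume : Measure ℝ).prod (volume : Measure ℂ))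
  set f : C2 → ℝ × ℂ := fun z => ((z 0).im, z 1)
  set a := Measure.addHaarScalarFactor (volume : Measure (EuclideanSpace ℝ (Fin 3))) μH[(3 : ℕ)]
  have ha : a ≠ 0 := Measure.addHaarScalarFactor_volume_hausdorffMeasure_ne_zero 3
  have hdim : Module.finrank ℝ (ℝ × ℂ) = 3 := by simp
  have hf : LipschitzWith 1 f := lipschitzWith_im_fst_prod_snd
  rw [hdim] at hvolume
  have hprod : c • ((volume : Measure ℝ).restrict (Icc (-(1 / 2)) (1 / 2))).prod
      ((volume : Measure ℂ).restrict (Metric.ball 0 (1 / 2))) ≤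
      ((μH[(3 : ℕ)] : Measure C2).restrict (frontier (egg p))).map f := by
    rw [Measure.prod_restrict, ← Measure.restrict_smul, ← hvolume]
    exact (Measure.restrict_mono_set _ (prod_ball_subset_image_frontier_egg hp)).trans
      (hausdorffMeasure_restrict_image_le_map hf (by positivity) _)
  have hmap : (eggSigma p).map z2 =
      (a • ((μH[(3 : ℕ)] : Measure C2).restrict (frontier (egg p))).map f).map Prod.snd := by
    rw [eggSigma, surfaceMeasure, Measure.euclideanHausdorffMeasure_def, Measure.restrict_smul,
      ← Measure.map_smul, Measure.map_map measurable_snd hf.continuous.measurable]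
    rfl
  refine ⟨a * c, mul_ne_zero ha hc, ?_⟩
  rw [hmap]
  refine le_trans (le_of_eq ?_) (Measure.map_mono (smul_mono_right a hprod) measurable_snd)
  have hlength : (volume : Measure ℝ).restrict (Icc (-(1 / 2)) (1 / 2)) univ = 1 := by
    norm_num [Measure.restrict_apply_univ, Real.volume_Icc]
  rw [Measure.map_smul, Measure.map_smul, Measure.map_snd_prod, hlength, one_smul, mul_smul]

theorem not_memLp_inv_map_eggSigma (hp : 1 ≤ p) : ¬ MemLp (fun w : ℂ => w⁻¹) 2
    (((eggSigma p).map z2).restrict (Metric.ball 0 (1 / 2))) := by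
  intro h
  obtain ⟨c, hc, hle⟩ := exists_smul_volume_ball_le_map_eggSigma hp
  have hvolume : (volume : Measure ℂ).restrict (Metric.ball 0 (1 / 2)) ≤
      c⁻¹ • ((eggSigma p).map z2).restrict (Metric.ball 0 (1 / 2)) := by
    have hrestrict := Measure.restrict_mono_measure hle (Metric.ball 0 (1 / 2))
    rw [Measure.restrict_smul, Measure.restrict_restrict Metric.isOpen_ball.measurableSet,
      inter_self] at hrestrict
    simpa [smul_smul, hc] using smul_mono_right (c⁻¹) hrestrict
  exact not_memLp_inv_volume_ball one_half_pos
    (h.of_measure_le_smul (c := (c⁻¹ : NNReal)) ENNReal.coe_ne_top hvolume)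

theorem half_le_norm_fst (hp : 1 ≤ p) {z : C2} (hz : eggFun p z = 1) (h1 : ‖z 1‖ ≤ 1 / 2) :
    1 / 2 ≤ ‖z 0‖ := by
  have hsmall {r : ℝ} (h0 : 0 ≤ r) (h1 : r ≤ 1) : r ^ (2 * p) ≤ r :=
    pow_le_of_le_one h0 h1 (by lia)
  have hz : ‖z 0‖ ^ (2 * p) + ‖z 1‖ ^ (2 * p) = 1 := hz
  by_contra! h0
  linarith [hsmall (norm_nonneg (z 0)) (by linarith), hsmall (norm_nonneg (z 1)) (by linarith)]

theorem not_memLp_laurentMonomial_eggSigma (hp : 1 ≤ p) {n : Fin 2 → ℤ} (h0 : 0 ≤ n 0)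
    (h1 : n 1 < 0) : ¬ MemLp (laurentMonomial n) 2 (eggSigma p) := by
  intro h
  have hball : MeasurableSet (Metric.ball (0 : ℂ) (1 / 2)) := Metric.isOpen_ball.measurableSet
  have hz2 : Measurable z2 := by unfold z2; fun_prop
  refine not_memLp_inv_map_eggSigma hp ?_
  rw [Measure.restrict_map hz2 hball, memLp_map_measure_iff measurable_inv.aestronglyMeasurable
    hz2.aemeasurable]
  refine h.restrict (z2 ⁻¹' Metric.ball 0 (1 / 2)) |>.of_le_mul (c := 2 ^ n 0)
    (measurable_inv.comp hz2).aestronglyMeasurable ?_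
  filter_upwards [ae_restrict_mem (hz2 hball), ae_restrict_of_ae (ae_eggFun_eq_one_eggSigma hp),
    ae_restrict_of_ae (isReinhardtMeasure_eggSigma hp).ae_ne_zero] with z hz hegg hne
  have hz : ‖z 1‖ < 1 / 2 := by simpa [z2] using hz
  have hfst : 1 ≤ 2 ^ n 0 * ‖z 0‖ ^ n 0 := by
    rw [← mul_zpow]
    exact one_le_zpow₀ (by linarith [half_le_norm_fst hp hegg hz.le]) h0
  have hsnd : ‖z 1‖⁻¹ ≤ ‖z 1‖ ^ n 1 := by
    rw [← zpow_neg_one]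
    exact zpow_le_zpow_right_of_le_one₀ (norm_pos_iff.2 (hne 1)) (by linarith) (by lia)
  calc ‖(z2 z)⁻¹‖ ≤ 1 * ‖z 1‖ ^ n 1 := by rwa [one_mul, norm_inv]
    _ ≤ 2 ^ n 0 * ‖z 0‖ ^ n 0 * ‖z 1‖ ^ n 1 := by gcongr
    _ = 2 ^ n 0 * ‖laurentMonomial n z‖ := by
        rw [laurentMonomial_fin_two, norm_mul, norm_zpow, norm_zpow, mul_assoc]

end SurfaceIntegrability

section MongeAmpere

open scoped RealInnerProductSpace

theorem inner_gradient (φ : C2 → ℝ) (z v : C2) : ⟪∇ φ z, v⟫ = fderiv ℝ φ z v := by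
  rw [gradient, InnerProductSpace.toDual_symm_apply]

theorem I_smul_I_smul (v : C2) : Complex.I • Complex.I • v = -v := by
  rw [smul_smul, Complex.I_mul_I, neg_one_smul]

theorem dc_eq_neg_inner_gradient (φ : C2 → ℝ) (z v : C2) : dc φ z v = -⟪∇ φ z, Complex.I • v⟫ := by
  rw [dc, inner_gradient]

theorem ddc_I_smul {φ : C2 → ℝ} {z : C2} {A : C2 →L[ℝ] C2} (hA : HasFDerivAt (∇ φ) A z) (v : C2) :
    ddc φ z v (Complex.I • v) = ⟪A v, v⟫ + ⟪A (Complex.I • v), Complex.I • v⟫ := by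
  have hderiv (w u : C2) : fderiv ℝ (fun x => dc φ x w) z u = -⟪A u, Complex.I • w⟫ := by
    have h : HasFDerivAt (fun x => dc φ x w) _ z :=
      ((hA.inner ℝ (hasFDerivAt_const (Complex.I • w) z)).neg).congr_of_eventuallyEq
        (.of_forall fun x => dc_eq_neg_inner_gradient φ x w)
    rw [h.fderiv]
    simp
  rw [ddc, hderiv, hderiv, I_smul_I_smul, inner_neg_right, neg_neg, sub_neg_eq_add]

theorem inner_smul_complexTangent (c : ℂ) (n : C2) : ⟪n, c • complexTangent n⟫ = 0 := by
  simp only [PiLp.inner_apply, Fin.sum_univ_two, complexTangent, Complex.inner, PiLp.smul_apply,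
    Matrix.cons_val_zero, Matrix.cons_val_one, smul_eq_mul, Complex.mul_re, Complex.mul_im,
    Complex.neg_re, Complex.neg_im, Complex.conj_re, Complex.conj_im]
  ring

theorem inner_gradient_smul_complexTangent (φ : C2 → ℝ) (z : C2) (c : ℂ) :
    ⟪∇ φ z, c • complexTangent (unitNormal φ z)⟫ = 0 := by
  rcases eq_or_ne (∇ φ z) 0 with h | h
  · rw [h, inner_zero_left]
  · have hgrad : ∇ φ z = ‖∇ φ z‖ • unitNormal φ z := by
      rw [unitNormal, smul_inv_smul₀ (norm_ne_zero_iff.2 h)]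
    rw [hgrad, real_inner_smul_left, inner_smul_complexTangent, mul_zero]

theorem dcWedgeDdc_unitNormal (φ : C2 → ℝ) (z : C2) :
    dcWedgeDdc φ z (Complex.I • unitNormal φ z) (complexTangent (unitNormal φ z))
      (Complex.I • complexTangent (unitNormal φ z)) =
    ‖∇ φ z‖ * ddc φ z (complexTangent (unitNormal φ z))
      (Complex.I • complexTangent (unitNormal φ z)) := by
  have hnormal : dc φ z (Complex.I • unitNormal φ z) = ‖∇ φ z‖ := by
    rw [dc_eq_neg_inner_gradient, I_smul_I_smul, inner_neg_right, neg_neg, unitNormal,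
      inner_smul_right, real_inner_self_eq_norm_mul_norm, ← mul_assoc, inv_mul_mul_self]
  have htangent : dc φ z (complexTangent (unitNormal φ z)) = 0 := by
    rw [dc_eq_neg_inner_gradient, inner_gradient_smul_complexTangent, neg_zero]
  have htangent_I : dc φ z (Complex.I • complexTangent (unitNormal φ z)) = 0 := by
    rw [dc_eq_neg_inner_gradient, smul_smul, inner_gradient_smul_complexTangent, neg_zero]
  rw [dcWedgeDdc, hnormal, htangent, htangent_I, zero_mul, zero_mul, sub_zero, add_zero]

variable {m : ℕ}

/-- The vector field `(|z₁|^{2m} z₁, |z₂|^{2m} z₂)`, which on the boundary of the egg of exponent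
`m + 1` is the gradient of the exhaustion function. -/
noncomputable def eggGradient (m : ℕ) (z : C2) : C2 :=
  WithLp.toLp 2 fun i => (‖z i‖ ^ 2) ^ m • z i

theorem eggGradient_apply (z : C2) (i : Fin 2) : eggGradient m z i = (‖z i‖ ^ 2) ^ m • z i := rfl

theorem hasFDerivAt_norm_sq_pow_smul (m : ℕ) (w : ℂ) :
    ∃ A : ℂ →L[ℝ] ℂ, HasFDerivAt (fun w : ℂ => (‖w‖ ^ 2) ^ m • w) A w ∧ ∀ v,
      ⟪A v, v⟫ + ⟪A (Complex.I * v), Complex.I * v⟫ = 2 * (m + 1) * (‖w‖ ^ 2) ^ m * ‖v‖ ^ 2 := by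
  have h := ((hasFDerivAt_id (𝕜 := ℝ) w).norm_sq.pow m).smul (hasFDerivAt_id w)
  refine ⟨_, h, fun v => ?_⟩
  have hortho : ⟪w, v⟫ ^ 2 + ⟪w, Complex.I * v⟫ ^ 2 = ‖w‖ ^ 2 * ‖v‖ ^ 2 := by
    simp only [Complex.inner, ← Complex.normSq_eq_norm_sq, Complex.normSq_apply, Complex.mul_re,
      Complex.mul_im, Complex.conj_re, Complex.conj_im, Complex.I_re, Complex.I_im]
    ring
  have hpow : m * (‖w‖ ^ 2) ^ (m - 1) * ‖w‖ ^ 2 = m * (‖w‖ ^ 2) ^ m := by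
    rcases m.eq_zero_or_pos with rfl | hm
    · simp
    · rw [mul_assoc, pow_sub_one_mul hm.ne']
  simp only [id_eq, nsmul_eq_mul, ContinuousLinearMap.comp_id, add_apply, smul_apply,
    ContinuousLinearMap.id_apply, ContinuousLinearMap.smulRight_apply, coe_innerSL_apply,
    Nat.cast_ofNat, smul_eq_mul, inner_add_left, real_inner_smul_left, real_inner_self_eq_norm_sq,
    norm_mul, Complex.norm_I, one_mul]
  linear_combination (2 * m * (‖w‖ ^ 2) ^ (m - 1)) * hortho + 2 * ‖v‖ ^ 2 * hpow

theorem hasFDerivAt_eggGradient (m : ℕ) (z : C2) :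
    ∃ A : C2 →L[ℝ] C2, HasFDerivAt (eggGradient m) A z ∧ ∀ v,
      ⟪A v, v⟫ + ⟪A (Complex.I • v), Complex.I • v⟫ =
        2 * (m + 1) * ∑ i, (‖z i‖ ^ 2) ^ m * ‖v i‖ ^ 2 := by
  choose A hA hAv using fun i => hasFDerivAt_norm_sq_pow_smul m (z i)
  have hcoord (i : Fin 2) : HasFDerivAt (fun x : C2 => eggGradient m x i)
      ((A i).comp (PiLp.proj 2 (𝕜 := ℝ) (fun _ : Fin 2 => ℂ) i)) z :=
    HasFDerivAt.comp (g := fun w : ℂ => (‖w‖ ^ 2) ^ m • w) z (hA i)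
      (PiLp.proj 2 (𝕜 := ℝ) (fun _ : Fin 2 => ℂ) i).hasFDerivAt
  obtain ⟨B, hB, hBA⟩ : ∃ B : C2 →L[ℝ] C2, HasFDerivAt (eggGradient m) B z ∧
      ∀ v i, B v i = A i (v i) :=
    ⟨_, (PiLp.hasFDerivAt_toLp (𝕜 := ℝ) 2 _).comp z (hasFDerivAt_pi.2 hcoord), fun v i => rfl⟩
  refine ⟨B, hB, fun v => ?_⟩
  simp only [PiLp.inner_apply, hBA, PiLp.smul_apply, smul_eq_mul, ← Finset.sum_add_distrib, hAv,
    Finset.mul_sum, mul_assoc]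

theorem hasGradientAt_eggFun (z : C2) :
    HasGradientAt (eggFun (m + 1)) ((2 * (m + 1) : ℝ) • eggGradient m z) z := by
  have hcoord (i : Fin 2) := (((PiLp.proj 2 (𝕜 := ℝ) (fun _ : Fin 2 => ℂ) i).hasFDerivAt
    (x := z)).norm_sq).pow (m + 1)
  have h := (hcoord 0).add (hcoord 1)
  rw [hasGradientAt_iff_hasFDerivAt]
  refine (h.congr_fderiv ?_).congr_of_eventuallyEq (.of_forall fun x => ?_)
  · ext v
    simp only [PiLp.proj_apply, add_tsub_cancel_right, nsmul_eq_mul, Nat.cast_add, Nat.cast_one,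
      add_apply, smul_apply, ContinuousLinearMap.comp_apply, coe_innerSL_apply, Nat.cast_ofNat,
      smul_eq_mul, map_smul, InnerProductSpace.toDual_apply_apply, PiLp.inner_apply,
      eggGradient_apply, real_inner_smul_left, Fin.sum_univ_two]
    ring
  · simp [eggFun, pow_mul]

theorem hasGradientAt_eggExhaustion {z : C2} (hz : z ≠ 0) :
    HasGradientAt (eggExhaustion (m + 1)) ((eggFun (m + 1) z)⁻¹ • eggGradient m z) z := by
  have h := ((hasGradientAt_eggFun (m := m) z).hasFDerivAt.log (eggFun_pos hz).ne').const_mul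
    (1 / (2 * ((m + 1 : ℕ) : ℝ)))
  rw [hasGradientAt_iff_hasFDerivAt]
  refine h.congr_fderiv ?_
  ext v
  simp only [Nat.cast_add, Nat.cast_one, map_smul, smul_apply,
    InnerProductSpace.toDual_apply_apply, smul_eq_mul]
  field_simp

theorem ddc_eggExhaustion {z v : C2} (hz : eggFun (m + 1) z = 1) (hv : ⟪eggGradient m z, v⟫ = 0)
    (hIv : ⟪eggGradient m z, Complex.I • v⟫ = 0) :
    ddc (eggExhaustion (m + 1)) z v (Complex.I • v) =
      2 * (m + 1) * ∑ i, (‖z i‖ ^ 2) ^ m * ‖v i‖ ^ 2 := by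
  obtain ⟨A, hA, hAv⟩ := hasFDerivAt_eggGradient m z
  have hgrad : ∇ (eggExhaustion (m + 1)) =ᶠ[𝓝 z] fun x =>
      (eggFun (m + 1) x)⁻¹ • eggGradient m x := by
    filter_upwards [isOpen_ne.mem_nhds (ne_zero_of_eggFun_eq_one (by lia) hz)] with x hx
    exact (hasGradientAt_eggExhaustion hx).gradient
  have hinv : HasFDerivAt (fun x => (eggFun (m + 1) x)⁻¹) _ z :=
    (hasDerivAt_inv (by rw [hz]; exact one_ne_zero)).comp_hasFDerivAt z
      (hasGradientAt_eggFun z).hasFDerivAt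
  rw [ddc_I_smul ((hinv.smul hA).congr_of_eventuallyEq hgrad), ← hAv]
  simp [hv, hIv, hz]

end MongeAmpere

section EggDensity

open scoped RealInnerProductSpace

variable {m : ℕ}

/-- The density of the Monge–Ampère boundary measure of the egg of exponent `m + 1` with respect
to surface area. -/
noncomputable def eggDensity (m : ℕ) (z : C2) : ℝ :=
  2 * (m + 1) * (‖z 0‖ * ‖z 1‖) ^ (2 * m) / ‖eggGradient m z‖

theorem norm_eggGradient_apply (z : C2) (i : Fin 2) :
    ‖eggGradient m z i‖ = ‖z i‖ ^ (2 * m) * ‖z i‖ := by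
  rw [eggGradient_apply, norm_smul, Real.norm_of_nonneg (by positivity), pow_mul]

theorem norm_eggGradient_torusRot (t : UnitAddTorus (Fin 2)) (z : C2) :
    ‖eggGradient m (torusRot t z)‖ = ‖eggGradient m z‖ := by
  simp only [EuclideanSpace.norm_eq, norm_eggGradient_apply, norm_torusRot_apply]

theorem norm_le_two_of_norm_apply_le_one {z : C2} (hz : ∀ i, ‖z i‖ ≤ 1) : ‖z‖ ≤ 2 := by
  rw [EuclideanSpace.norm_eq, Real.sqrt_le_left two_pos.le, Fin.sum_univ_two]
  linarith [pow_le_one₀ (n := 2) (norm_nonneg _) (hz 0),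
    pow_le_one₀ (n := 2) (norm_nonneg _) (hz 1)]

theorem inner_eggGradient_self (z : C2) : ⟪eggGradient m z, z⟫ = eggFun (m + 1) z := by
  simp only [PiLp.inner_apply, Fin.sum_univ_two, eggGradient_apply, real_inner_smul_left,
    real_inner_self_eq_norm_sq, eggFun]
  ring

theorem norm_eggGradient_le_two {z : C2} (hz : eggFun (m + 1) z = 1) : ‖eggGradient m z‖ ≤ 2 := by
  refine norm_le_two_of_norm_apply_le_one fun i => ?_
  have hi := norm_le_one_of_eggFun_le_one (by lia) hz.le i
  rw [norm_eggGradient_apply]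
  exact mul_le_one₀ (pow_le_one₀ (norm_nonneg _) hi) (norm_nonneg _) hi

theorem half_le_norm_eggGradient {z : C2} (hz : eggFun (m + 1) z = 1) :
    1 / 2 ≤ ‖eggGradient m z‖ := by
  have hle : 1 ≤ ‖eggGradient m z‖ * 2 := calc
    1 = ⟪eggGradient m z, z⟫ := by rw [inner_eggGradient_self, hz]
    _ ≤ ‖eggGradient m z‖ * ‖z‖ := real_inner_le_norm _ _
    _ ≤ ‖eggGradient m z‖ * 2 := by
      gcongr
      exact norm_le_two_of_norm_apply_le_one (norm_le_one_of_eggFun_le_one (by lia) hz.le)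
  linarith

theorem gradient_eggExhaustion {z : C2} (hz : eggFun (m + 1) z = 1) :
    ∇ (eggExhaustion (m + 1)) z = eggGradient m z := by
  rw [(hasGradientAt_eggExhaustion (ne_zero_of_eggFun_eq_one (by lia) hz)).gradient, hz, inv_one,
    one_smul]

theorem dcWedgeDdc_eggExhaustion {z : C2} (hz : eggFun (m + 1) z = 1) :
    dcWedgeDdc (eggExhaustion (m + 1)) z (Complex.I • unitNormal (eggExhaustion (m + 1)) z)
      (complexTangent (unitNormal (eggExhaustion (m + 1)) z))
      (Complex.I • complexTangent (unitNormal (eggExhaustion (m + 1)) z)) = eggDensity m z := by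
  have htangent := inner_gradient_smul_complexTangent (eggExhaustion (m + 1)) z
  rw [gradient_eggExhaustion hz] at htangent
  have htangent_one := htangent 1
  rw [one_smul] at htangent_one
  have hnormal (i : Fin 2) : ‖unitNormal (eggExhaustion (m + 1)) z i‖ ^ 2 =
      ‖eggGradient m z‖⁻¹ ^ 2 * (‖z i‖ ^ (2 * m) * ‖z i‖) ^ 2 := by
    rw [unitNormal, gradient_eggExhaustion hz, PiLp.smul_apply, norm_smul, norm_inv, norm_norm,
      mul_pow, norm_eggGradient_apply]
  have hne : ‖eggGradient m z‖ ≠ 0 := by linarith [half_le_norm_eggGradient hz]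
  have hz : ‖z 0‖ ^ (2 * (m + 1)) + ‖z 1‖ ^ (2 * (m + 1)) = 1 := hz
  rw [dcWedgeDdc_unitNormal, ddc_eggExhaustion hz htangent_one (htangent _), eggDensity,
    gradient_eggExhaustion hz, Fin.sum_univ_two]
  simp only [complexTangent, PiLp.toLp_apply, Matrix.cons_val_zero, Matrix.cons_val_one, norm_neg,
    RCLike.norm_conj, hnormal, ← pow_mul]
  field_simp
  linear_combination (‖z 0‖ * ‖z 1‖) ^ (2 * m) * hz

theorem eggOmega_eq_withDensity (m : ℕ) :
    eggOmega (m + 1) =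
      (eggSigma (m + 1)).withDensity fun z => ENNReal.ofReal (eggDensity m z) := by
  rw [eggOmega, mongeAmpereBoundaryMeasure, ← eggSigma]
  refine withDensity_congr_ae ?_
  filter_upwards [ae_eggFun_eq_one_eggSigma (by lia)] with z hz
  exact congrArg ENNReal.ofReal (dcWedgeDdc_eggExhaustion hz)

theorem measurable_eggDensity : Measurable (eggDensity m) := by
  have hgrad : Continuous (eggGradient m) :=
    (PiLp.continuous_toLp 2 _).comp (continuous_pi fun i => by fun_prop)
  exact .div (by fun_prop) hgrad.norm.measurable

theorem eggDensity_torusRot (t : UnitAddTorus (Fin 2)) (z : C2) :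
    eggDensity m (torusRot t z) = eggDensity m z := by
  simp only [eggDensity, norm_eggGradient_torusRot, norm_torusRot_apply]

theorem norm_laurentMonomial_const_sq (z : C2) :
    ‖laurentMonomial (fun _ => (m : ℤ)) z‖ ^ 2 = (‖z 0‖ * ‖z 1‖) ^ (2 * m) := by
  rw [laurentMonomial_fin_two, zpow_natCast, zpow_natCast, norm_mul, norm_pow, norm_pow]
  ring

theorem norm_laurentMonomial_sq_le_eggDensity {z : C2} (hz : eggFun (m + 1) z = 1) :
    ‖laurentMonomial (fun _ => (m : ℤ)) z‖ ^ 2 ≤ eggDensity m z := by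
  rw [norm_laurentMonomial_const_sq, eggDensity,
    le_div_iff₀ (by linarith [half_le_norm_eggGradient hz]), mul_comm]
  gcongr
  linarith [norm_eggGradient_le_two hz, m.cast_nonneg (α := ℝ)]

theorem eggDensity_le_norm_laurentMonomial_sq {z : C2} (hz : eggFun (m + 1) z = 1) :
    eggDensity m z ≤ 4 * (m + 1) * ‖laurentMonomial (fun _ => (m : ℤ)) z‖ ^ 2 := by
  have hhalf := half_le_norm_eggGradient hz
  rw [norm_laurentMonomial_const_sq, eggDensity, div_le_iff₀ (by linarith)]
  have hnonneg : 0 ≤ (m + 1) * (‖z 0‖ * ‖z 1‖) ^ (2 * m) := by positivity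
  nlinarith

theorem memLp_laurentMonomial_eggOmega_iff {n : Fin 2 → ℤ} :
    MemLp (laurentMonomial n) 2 (eggOmega (m + 1)) ↔
      MemLp (laurentMonomial (fun i => m + n i)) 2 (eggSigma (m + 1)) := by
  set w : C2 → ℂ := laurentMonomial fun _ => (m : ℤ)
  have hw : Measurable w := measurable_laurentMonomial _
  have hegg := ae_eggFun_eq_one_eggSigma (p := m + 1) (by lia)
  have hofReal (z : C2) : ENNReal.ofReal (‖w z‖ ^ 2) = ‖w z‖ₑ ^ 2 := by
    rw [ENNReal.ofReal_pow (norm_nonneg _), ofReal_norm]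
  have hlower : (eggSigma (m + 1)).withDensity (fun z => ‖w z‖ₑ ^ 2) ≤ eggOmega (m + 1) := by
    rw [eggOmega_eq_withDensity]
    refine withDensity_mono ?_
    filter_upwards [hegg] with z hz
    rw [← hofReal]
    exact ENNReal.ofReal_le_ofReal (norm_laurentMonomial_sq_le_eggDensity hz)
  have hupper : eggOmega (m + 1) ≤ ENNReal.ofReal (4 * (m + 1)) •
      (eggSigma (m + 1)).withDensity (fun z => ‖w z‖ₑ ^ 2) := by
    rw [eggOmega_eq_withDensity, ← withDensity_smul _ (hw.enorm.pow_const 2)]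
    refine withDensity_mono ?_
    filter_upwards [hegg] with z hz
    rw [Pi.smul_apply, smul_eq_mul, ← hofReal, ← ENNReal.ofReal_mul (by positivity)]
    exact ENNReal.ofReal_le_ofReal (eggDensity_le_norm_laurentMonomial_sq hz)
  calc MemLp (laurentMonomial n) 2 (eggOmega (m + 1))
      ↔ MemLp (laurentMonomial n) 2 ((eggSigma (m + 1)).withDensity fun z => ‖w z‖ₑ ^ 2) :=
        ⟨fun h => h.mono_measure hlower, fun h => h.of_measure_le_smul ENNReal.ofReal_ne_top hupper⟩
    _ ↔ MemLp (fun z => w z * laurentMonomial n z) 2 (eggSigma (m + 1)) :=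
        memLp_two_withDensity_enorm_sq_iff (measurable_laurentMonomial n) hw
    _ ↔ MemLp (laurentMonomial (fun i => m + n i)) 2 (eggSigma (m + 1)) := by
        refine memLp_congr_ae ?_
        filter_upwards [(isReinhardtMeasure_eggSigma (by lia)).ae_ne_zero] with z hz
        exact (laurentMonomial_add _ n hz).symm

theorem not_memLp_laurentMonomial_eggOmega {n : Fin 2 → ℤ} (h0 : 0 ≤ n 0) (h1 : n 1 < -(m : ℤ)) :
    ¬ MemLp (laurentMonomial n) 2 (eggOmega (m + 1)) := by
  rw [memLp_laurentMonomial_eggOmega_iff]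
  exact not_memLp_laurentMonomial_eggSigma (by lia) (by lia) (by lia)

theorem memLp_laurentMonomial_eggOmega {n : Fin 2 → ℤ} (hn : ∀ i, -(m : ℤ) ≤ n i) :
    MemLp (laurentMonomial n) 2 (eggOmega (m + 1)) := by
  have := (isReinhardtMeasure_eggSigma (p := m + 1) (by lia)).isFiniteMeasure
  rw [memLp_laurentMonomial_eggOmega_iff]
  exact memLp_laurentMonomial_of_ae_eggFun_eq_one (by lia) (ae_eggFun_eq_one_eggSigma (by lia))
    fun i => by simpa [neg_le_iff_add_nonneg'] using hn i

theorem isReinhardtMeasure_eggOmega (m : ℕ) : IsReinhardtMeasure (eggOmega (m + 1)) := by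
  have hfin : eggOmega (m + 1) univ < ∞ := by
    have hone : MemLp (fun _ : C2 => (1 : ℂ)) 2 (eggOmega (m + 1)) := by
      have hzero : laurentMonomial (0 : Fin 2 → ℤ) = fun _ => 1 := by
        ext
        simp [laurentMonomial]
      exact hzero ▸ memLp_laurentMonomial_eggOmega fun _ => by simp
    simpa [memLp_const_iff] using hone
  rw [eggOmega_eq_withDensity] at hfin ⊢
  rw [withDensity_apply _ .univ, Measure.restrict_univ] at hfin
  exact (isReinhardtMeasure_eggSigma (by lia)).withDensity measurable_eggDensity.ennreal_ofReal
    hfin.ne fun t z => by rw [eggDensity_torusRot]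

theorem ae_eggFun_eq_one_eggOmega (m : ℕ) : ∀ᵐ z ∂eggOmega (m + 1), eggFun (m + 1) z = 1 := by
  rw [eggOmega_eq_withDensity]
  exact (withDensity_absolutelyContinuous _ _).ae_le (ae_eggFun_eq_one_eggSigma (by lia))

end EggDensity

section Peak

variable {ν : Measure C2} {p : ℕ}

theorem IsReinhardtMeasure.measure_norm_snd_lt_ne_zero (hν : IsReinhardtMeasure ν) {k : ℕ}
    (hk : ¬ MemLp (laurentMonomial ![0, -(k : ℤ)]) 2 ν) {δ : ℝ} (hδ : 0 < δ) :
    ν {z | ‖z 1‖ < δ} ≠ 0 := by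
  have := hν.isFiniteMeasure
  refine fun hnull => hk (.of_bound (measurable_laurentMonomial _).aestronglyMeasurable
    (δ ^ k)⁻¹ ?_)
  filter_upwards [measure_eq_zero_iff_ae_notMem.1 hnull] with z hz
  have hz : δ ≤ ‖z 1‖ := not_lt.1 hz
  rw [laurentMonomial_eq_inv_z2_pow, norm_inv, norm_pow]
  gcongr
  exact hz

theorem peaksOnHyperplane_of_measure_norm_snd_lt_ne_zero (hp : 1 ≤ p)
    (hae : ∀ᵐ z ∂ν, eggFun p z = 1) (hsnd : ∀ δ > 0, ν {z | ‖z 1‖ < δ} ≠ 0) :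
    PeaksOnHyperplane ν := by
  intro δ hδ
  let e := NNReal.powOrderIso (2 * p) (by lia)
  obtain ⟨d, hd0, hd1, hdδ⟩ : ∃ d : NNReal, 0 < d ∧ d ≤ 1 ∧ (d : ℝ) ≤ δ :=
    ⟨min 1 δ.toNNReal, by positivity, min_le_left _ _, by simp [hδ.le]⟩
  have hegg : ∀ᵐ z ∂ν, e ‖z 0‖₊ + e ‖z 1‖₊ = 1 := by
    filter_upwards [hae] with z hz
    exact NNReal.coe_injective hz
  have hhalf : e (d / 2) < e d := e.strictMono (NNReal.half_lt_self hd0.ne')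
  have hle : e d ≤ 1 := pow_le_one₀ zero_le hd1
  refine ⟨e.symm (1 - e d), e.symm (1 - e (d / 2)), e.symm.strictMono ?_, ?_, fun hnull => ?_⟩
  · exact tsub_lt_tsub_left_of_le hle hhalf
  · filter_upwards [hegg] with z hz hz1
    have hmono : e d ≤ e ‖z 1‖₊ := e.monotone (NNReal.coe_le_coe.1 (hdδ.trans hz1))
    rw [e.le_symm_apply, ← hz]
    exact le_tsub_of_add_le_left (by rw [add_comm]; gcongr)
  · refine hsnd (d / 2) (by positivity) (measure_mono_null_ae ?_ hnull)
    filter_upwards [hegg] with z hz (hz1 : ‖z 1‖ < d / 2)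
    have hmono : e ‖z 1‖₊ ≤ e (d / 2) := e.monotone (NNReal.coe_le_coe.1 (by simpa using hz1.le))
    change e.symm (1 - e (d / 2)) ≤ ‖z 0‖₊
    rw [e.symm_apply_le, tsub_le_iff_right, ← hz]
    gcongr

end Peak

theorem theorem5p1 (p : ℕ) (hp : 1 ≤ p) :
    (∀ k : ℕ, hardySpace (egg p) (eggSigma p) z2 k = hardySpace (egg p) (eggSigma p) z2 0) ∧
    (∀ k : ℕ, k + 1 ≤ p - 1 →
      hardySpace (egg p) (eggOmega p) z2 k ⊂ hardySpace (egg p) (eggOmega p) z2 (k + 1)) ∧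
    (∀ k : ℕ, p ≤ k →
      hardySpace (egg p) (eggOmega p) z2 (p - 1) = hardySpace (egg p) (eggOmega p) z2 k) ∧
    mulPowSet z2 1 (hardySpace (egg p) (eggOmega p) z2 1) ⊂
      hardySpace (egg p) (eggOmega p) z2 0 ∧
    (∀ k : ℕ, mulPowSet z2 (k + 1) (hardySpace (egg p) (eggOmega p) z2 (k + 1)) ⊂
      mulPowSet z2 k (hardySpace (egg p) (eggOmega p) z2 k)) := by
  obtain ⟨m, rfl⟩ : ∃ m, p = m + 1 := ⟨p - 1, by lia⟩
  have hσ := isReinhardtMeasure_eggSigma hp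
  have hω := isReinhardtMeasure_eggOmega m
  have hσegg := hσ.isStrictlyReinhardt_egg hp (ae_eggFun_eq_one_eggSigma hp)
  have hωae := ae_eggFun_eq_one_eggOmega m
  have hωegg := hω.isStrictlyReinhardt_egg hp hωae
  have hcharge : ∀ δ > 0, eggOmega (m + 1) {z | ‖z 1‖ < δ} ≠ 0 := fun δ hδ =>
    hω.measure_norm_snd_lt_ne_zero (k := m + 1)
      (not_memLp_laurentMonomial_eggOmega (by simp) (by simp)) hδ
  have hω0 : eggOmega (m + 1) ≠ 0 := fun h => hcharge 1 one_pos (by simp [h])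
  have hpeak := peaksOnHyperplane_of_measure_norm_snd_lt_ne_zero hp hωae hcharge
  have hcoord := memLp_top_apply_of_ae_eggFun_eq_one hp hωae
  have hchain (k : ℕ) := mulPowSet_hardySpace_ssubset (ψ := z2) (hcoord 1)
    (hω.ae_ne_zero.mono fun z hz => hz 1)
    (hω.mulLp_image_hardySpace_ne (Ω := egg (m + 1)) (k := k) hpeak (hcoord 0) (hcoord 1))
  refine ⟨fun k => ?_, fun k hk => ?_, fun k hk => ?_, ?_, hchain⟩
  · exact hσ.hardySpace_eq_of_not_memLp hσegg
      (fun n h0 h1 => not_memLp_laurentMonomial_eggSigma hp h0 (by simpa using h1)) k.zero_le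
  · exact hω.hardySpace_ssubset_succ hωegg hω0
      (memLp_laurentMonomial_eggOmega (Fin.forall_fin_two.2 ⟨by simp, neg_le_neg (by lia)⟩))
  · exact (hω.hardySpace_eq_of_not_memLp hωegg
      (fun n h0 h1 => not_memLp_laurentMonomial_eggOmega h0 h1) (by lia)).symm
  · simpa only [mulPowSet_zero] using hchain 0
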